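/- Let $n \ge 1$ and let $x_1,\dots,x_n \ge 0$ be integers. The sun graph $\mathcal S = \mathcal S(x_1,\dots,x_n)$ is the graph obtained from a cycle with $2n$ vertices, labeled in cyclic order $v_1,\dots,v_{2n}$ (for $n=1$: two vertices joined by two edges), by attaching to $v_{2i-1}$, for each $i$, $x_i$ additional edges (rays), each of which ends in a new vertex of its own. Regard $\mathcal S$ as a topological space (a one-dimensional CW complex), let $\mathrm{Conf}_3(\mathcal S) = (\mathcal S^3 - \Delta)/S_3$ be the configuration space of three unordered distinct points of $\mathcal S$, where $\Delta$ is the set of triples in $\mathcal S^3$ whose entries are not pairwise distinct and the symmetric group $S_3$ permutes the factors, and let $B_3(\mathcal S) = \pi_1(\mathrm{Conf}_3(\mathcal S))$ be the $3$-strand graph braid group of $\mathcal S$. Then, for every sun graph $\mathcal S$ and every choice of base point, $B_3(\mathcal S)$ is a free group. -/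

import Mathlib

/-- A (directed presentation of a) multigraph: loops and parallel edges are allowed. The orientation
of an edge serves only to parametrize it by the unit interval. -/
structure Multigraph where
  /-- the vertices -/
  V : Type
  /-- the edges -/
  E : Type
  /-- the initial endpoint of an edge -/
  src : E → V
  /-- the terminal endpoint of an edge -/
  tgt : E → V

namespace Multigraph

/-- The disjoint union of the vertices of `G` and of one copy of `[0,1]` for each edge of `G`. -/
def Cells (G : Multigraph) : Type := G.V ⊕ (G.E × unitInterval)

/-- The disjoint union topology (vertices and edges form discrete sets). -/
instance (G : Multigraph) : TopologicalSpace G.Cells :=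
  letI : TopologicalSpace G.V := ⊥
  letI : TopologicalSpace G.E := ⊥
  inferInstanceAs (TopologicalSpace (G.V ⊕ (G.E × unitInterval)))

/-- The ends of the copy of `[0,1]` that belongs to an edge are glued to its endpoints. -/
inductive Glue (G : Multigraph) : G.Cells → G.Cells → Prop
  | src (e : G.E) : Glue G (Sum.inr (e, 0)) (Sum.inl (G.src e))
  | tgt (e : G.E) : Glue G (Sum.inr (e, 1)) (Sum.inl (G.tgt e))

/-- The graph as a topological space (a one-dimensional CW complex): the quotient of the disjoint
union of its vertices and edges by the gluing, with the quotient topology. -/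
def Realization (G : Multigraph) : Type := Quot G.Glue

instance (G : Multigraph) : TopologicalSpace G.Realization :=
  inferInstanceAs (TopologicalSpace (Quot G.Glue))

end Multigraph

/-- The configuration space of `k` ordered distinct points of `X`: the complement in `X ^ k` of
the fat diagonal, with the subspace topology. -/
abbrev OrderedConf (k : ℕ) (X : Type) : Type := {p : Fin k → X // Function.Injective p}

/-- Two ordered configurations are equivalent if they differ by a permutation of the indices. -/
def confSetoid (k : ℕ) (X : Type) : Setoid (OrderedConf k X) where
  r p q := ∃ σ : Equiv.Perm (Fin k), p.1 ∘ σ = q.1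
  iseqv :=
    { refl := fun _ => ⟨1, rfl⟩
      symm := by
        rintro p q ⟨σ, h⟩
        exact ⟨σ.symm, by rw [← h]; funext i; simp⟩
      trans := by
        rintro p q r ⟨σ, h⟩ ⟨τ, h'⟩
        exact ⟨τ.trans σ, by rw [← h', ← h]; rfl⟩ }

/-- The configuration space of `k` unordered distinct points of `X`: the quotient of the ordered
configuration space by the symmetric group, with the quotient topology. -/
def Conf (k : ℕ) (X : Type) : Type := Quotient (confSetoid k X)

instance (k : ℕ) (X : Type) [TopologicalSpace X] : TopologicalSpace (Conf k X) :=
  inferInstanceAs (TopologicalSpace (Quotient (confSetoid k X)))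

/-- The `k`-strand braid group of the graph `G` at the base configuration `c`. -/
abbrev GraphBraidGroup (k : ℕ) (G : Multigraph) (c : Conf k G.Realization) : Type :=
  FundamentalGroup (Conf k G.Realization) c

/-- The sun graph `S(x_1, …, x_n)`: a `2n`-cycle, with `x_i` rays attached to its `(2i-1)`-st
vertex. Indices start at `0` here, so that the rays `(i, 0), …, (i, x i - 1)` are attached to the
vertex `2 * i` of the cycle; each ray `(i, k)` ends in a vertex of its own. -/
def sunGraph {n : ℕ} (x : Fin n → ℕ) : Multigraph where
  V := Fin (2 * n) ⊕ (Σ i : Fin n, Fin (x i))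
  E := Fin (2 * n) ⊕ (Σ i : Fin n, Fin (x i))
  src := Sum.elim
    (fun j => Sum.inl j)
    (fun r => Sum.inl ⟨2 * r.1.val, by have := r.1.isLt; omega⟩)
  tgt := Sum.elim
    (fun j => Sum.inl ⟨(j.val + 1) % (2 * n), Nat.mod_lt _ (by have := j.isLt; omega)⟩)
    (fun r => Sum.inr r)

/-! ### Coverings and path classes -/

open Topology Set

/-! The sun graph is a circle with finitely many rays (`sunGraph.homeomorphRayedCircle`). Fix a
point `m` of the circle away from the rays. Three open sets cover the unordered configuration space.
In `U₀` (`cutPatterns`) either the particles lie over distinct points of the circle other than `m`,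
or at least two of them are on rays at a common centre. In `U₁` (`basePatterns`) one particle is
near `m`, nearer than the other two, which lie over distinct points. In `U₂` (`starPatterns`) one
particle is near a centre, nearer than the other two, and one of these is on a ray there.

Each set is a union of patterns. Retracting particles to the circle, except those on rays at the
centre, deforms a pattern to a set of coordinates cut out by linear inequalities, hence convex
(`Pattern.contractibleSpace`). A configuration fits a family in at most one way (`IsRigid`), so the
patterns of a family have disjoint, embedded images in the quotient. Loops inside each `Uᵢ` are
therefore null-homotopic.

Hence on each `Uᵢ` there are path classes from the base point that are compatible with paths inside
`Uᵢ`. Their comparisons `c i j` form a locally constant cocycle with values in the fundamental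
group, and only the triple overlaps impose relations `c 0 1 * c 1 2 = c 0 2`. These relations can be
solved. The overlap `U₀ ∩ U₁` has at most two connected pieces, with the particle near `m` to its
left or to its right. The distinction extends to a clopen one on `U₀ ∩ (U₁ ∪ U₂)`: in `U₀ ∩ U₂`, ask
whether the centre precedes the free particle on the circle cut at `m`; configurations with two
particles on rays at the centre count as right. After a change of gauge, `c 0 1` is a function `b'`
taking one value on each side, and `b'⁻¹ * c 0 2` and `c 1 2` glue to one locally constant function
on `(U₀ ∪ U₁) ∩ U₂`, with no relation left.

So the cocycle lifts to the free group on one letter for the left side and one for each component of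
`(U₀ ∪ U₁) ∩ U₂` (`isFreeGroup_fundamentalGroup_of_three_sets`). The covering built from the lifted
cocycle has injective monodromy, because the path classes can be read off from the free group
(`isFreeGroup_fundamentalGroup_of_gauge`). The fundamental group thus embeds in a free group, and
Nielsen–Schreier applies. -/

/-- If a quotient covering admits a path-class potential, i.e. a choice, for each point `y` above the
path component of `x₀`, of a homotopy class of paths from `x₀` to the image of `y`, and this choice
is locally parallel, then the deck group detects all of the fundamental group. -/
theorem IsQuotientCoveringMap.fundamentalGroupToMulOpposite_injective_of_parallel
    {X Y F : Type*} [TopologicalSpace X] [TopologicalSpace Y] [Group F] [MulAction F Y]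
    {p : Y → X} (hp : IsQuotientCoveringMap p F) {x₀ : X} (e : p ⁻¹' {x₀})
    (α : ∀ y : Y, Joined x₀ (p y) → Path.Homotopic.Quotient x₀ (p y))
    (hα : ∀ y : Y, ∃ N ∈ 𝓝 y, ∀ (y₁ y₂ : Y) (Γ : Path y₁ y₂), (∀ t, Γ t ∈ N) →
      ∀ h₁ h₂, (α y₁ h₁).trans (.mk (Γ.map hp.isCoveringMap.continuous)) = α y₂ h₂) :
    Function.Injective (hp.fundamentalGroupToMulOpposite e) := by
  have cont := hp.isCoveringMap.continuous
  obtain ⟨e, rfl⟩ := e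
  have key : ∀ (y₁ y₂ : Y) (Γ : Path y₁ y₂) h₁ h₂,
      (α y₁ h₁).trans (.mk (Γ.map cont)) = α y₂ h₂ := by
    intro y₁ y₂ Γ h₁
    have hJ : ∀ t, Joined (p e) (p (Γ t)) := fun t =>
      h₁.trans (by
        have : Joined (p (Γ 0)) (p (Γ t)) := ⟨(Γ.subpath 0 t).map cont⟩
        rwa [Γ.source] at this)
    have hJ0 := hJ 0
    -- The times up to which transport along `Γ` agrees with `α`. Membership is locally constant in
    -- time, so the set is clopen, and it contains 0.
    let S : Set unitInterval :=
      {t | (α _ (hJ 0)).trans (.mk ((Γ.subpath 0 t).map cont)) = α _ (hJ t)}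
    have loc : ∀ t, ∀ᶠ s in 𝓝 t, (s ∈ S ↔ t ∈ S) := by
      intro t
      obtain ⟨N, hN, hpar⟩ := hα (Γ t)
      have : Γ ⁻¹' N ∈ 𝓝 t := Γ.continuous.continuousAt hN
      obtain ⟨ε, hε, hball⟩ := Metric.mem_nhds_iff.mp this
      refine Filter.mem_of_superset (Metric.ball_mem_nhds t hε) fun s hs => ?_
      have hsub : ∀ u, (Γ.subpath t s) u ∈ N := by
        intro u
        have : (Γ.subpath t s) u ∈ range (Γ.subpath t s) := ⟨u, rfl⟩
        rw [Path.range_subpath] at this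
        obtain ⟨w, hw, hw'⟩ := this
        rw [← hw']
        refine hball (Metric.mem_ball.mpr (lt_of_le_of_lt ?_ (Metric.mem_ball.mp hs)))
        rw [Subtype.dist_eq, Subtype.dist_eq, Real.dist_eq, Real.dist_eq]
        refine abs_sub_left_of_mem_uIcc ?_
        rcases Set.mem_uIcc.mp hw with h | h
        · exact Set.mem_uIcc.mpr (Or.inl h)
        · exact Set.mem_uIcc.mpr (Or.inr h)
      have h := hpar _ _ (Γ.subpath t s) hsub (hJ t) (hJ s)
      have h3 : (Path.Homotopic.Quotient.mk ((Γ.subpath 0 t).map cont)).trans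
          (.mk ((Γ.subpath t s).map cont)) = .mk ((Γ.subpath 0 s).map cont) := by
        rw [← Path.Homotopic.Quotient.mk_trans, ← Path.map_trans]
        exact Path.Homotopic.Quotient.eq.mpr
          (Path.Homotopic.map ⟨Path.Homotopy.subpathTransSubpath Γ 0 t s⟩ ⟨p, cont⟩)
      show (_ = _) ↔ (_ = _)
      rw [← h3, ← Path.Homotopic.Quotient.trans_assoc, ← h]
      constructor
      · intro H
        have := congrArg (fun z => z.trans (.symm (.mk ((Γ.subpath t s).map cont)))) H
        simpa [Path.Homotopic.Quotient.trans_assoc] using this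
      · intro H
        rw [H]
    have hS : IsClopen S := by
      constructor
      · rw [← isOpen_compl_iff, isOpen_iff_mem_nhds]
        intro t ht
        filter_upwards [loc t] with s hs
        exact fun h => ht (hs.mp h)
      · rw [isOpen_iff_mem_nhds]
        intro t ht
        filter_upwards [loc t] with s hs
        exact hs.mpr ht
    have h0 : (0 : unitInterval) ∈ S := by
      show (_ = _)
      rw [Path.subpath_self]
      exact Path.Homotopic.Quotient.trans_refl _
    have h1 : (1 : unitInterval) ∈ S := by
      rw [hS.eq_univ ⟨0, h0⟩]; trivial
    have h1' : (α _ (hJ 0)).trans (.mk ((Γ.subpath 0 1).map cont)) = α _ (hJ 1) := h1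
    clear h1 h0 hS loc S
    intro h₂
    rw [Path.subpath_zero_one] at h1'
    obtain ⟨Γ, hs, ht⟩ := Γ
    change Γ 0 = y₁ at hs
    change Γ 1 = y₂ at ht
    subst hs ht
    exact h1'
  rw [injective_iff_map_eq_one]
  intro γ hγ
  rw [hp.fundamentalGroupToMulOpposite_eq_one_iff] at hγ
  -- Since the deck transformation is trivial, the lift of `γ` closes up. Transport around it fixes
  -- the invertible class `α e`, which forces `γ = 1`.
  obtain ⟨Γ, hΓ⟩ := Path.Homotopic.Quotient.mk_surjective
    ((hp.isCoveringMap.liftPathQuotient γ ⟨e, rfl⟩).cast rfl congr($hγ.symm.1))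
  have h2 := key e e Γ (Joined.refl _) (Joined.refl _)
  have h3 : Path.Homotopic.Quotient.mk (Γ.map cont) = γ := by
    change (Path.Homotopic.Quotient.mk Γ).map ⟨p, cont⟩ = γ
    rw [hΓ, Path.Homotopic.Quotient.map_cast, IsCoveringMap.map_liftPathQuotient]
    exact (Path.Homotopic.Quotient.cast_cast ..).trans (Path.Homotopic.Quotient.cast_rfl_rfl _)
  rw [h3] at h2
  have := congrArg (fun z => (α e (Joined.refl _)).symm.trans z) h2
  simp only [← Path.Homotopic.Quotient.trans_assoc, Path.Homotopic.Quotient.symm_trans,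
    Path.Homotopic.Quotient.refl_trans] at this
  exact this

/-- The fibre coordinate of a point of a bundle core, in the preferred trivialization. -/
def FiberBundleCore.fiberCoord {X ι F : Type*} [TopologicalSpace X] [TopologicalSpace F]
    (Z : FiberBundleCore ι X F) (y : Z.TotalSpace) : F := y.2

/-! ### Principal bundles with discrete structure group -/

section GaugeBundle

variable {X ι F : Type*} [TopologicalSpace X] [Group F] [TopologicalSpace F] [DiscreteTopology F]

/-- The principal bundle with discrete structure group `F` that has, on an open cover, the
transition functions `h i * (h j)⁻¹`, which are assumed to be locally constant. -/
noncomputable def gaugeBundle (U : ι → Set X) (hU : ∀ i, IsOpen (U i)) (hcov : ∀ x, ∃ i, x ∈ U i)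
    (h : ι → X → F)
    (hloc : ∀ i j, ∀ p ∈ U i ∩ U j, ∀ᶠ q in 𝓝 p, h i q * (h j q)⁻¹ = h i p * (h j p)⁻¹) :
    FiberBundleCore ι X F where
  baseSet := U
  isOpen_baseSet := hU
  indexAt x := (hcov x).choose
  mem_baseSet_at x := (hcov x).choose_spec
  coordChange i j p f := f * (h i p * (h j p)⁻¹)
  coordChange_self i x _ v := by simp
  continuousOn_coordChange i j := by
    rintro ⟨p, f⟩ ⟨hp, -⟩
    refine ContinuousAt.continuousWithinAt ?_
    have : ContinuousAt (fun x : X × F => x.2 * (h i p * (h j p)⁻¹)) (p, f) :=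
      (continuous_of_discreteTopology (f := fun g : F => g * (h i p * (h j p)⁻¹))).continuousAt.comp
        continuousAt_snd
    refine this.congr ?_
    filter_upwards [continuousAt_fst.eventually (hloc i j p hp)] with x hx
    rw [← hx]
  coordChange_comp i j k x _ v := by group

variable (U : ι → Set X) (hU : ∀ i, IsOpen (U i)) (hcov : ∀ x, ∃ i, x ∈ U i) (h : ι → X → F)
    (hloc : ∀ i j, ∀ p ∈ U i ∩ U j, ∀ᶠ q in 𝓝 p, h i q * (h j q)⁻¹ = h i p * (h j p)⁻¹)

/-- Coordinate changes multiply on the right, so left multiplication on the fibre means the same in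
every chart. This makes it continuous, and simply transitive on fibres. -/
noncomputable instance : MulAction F (gaugeBundle U hU hcov h hloc).TotalSpace where
  smul a y := ⟨y.1, a * FiberBundleCore.fiberCoord _ y⟩
  one_smul y := congrArg (fun f : F => (⟨y.1, f⟩ : (gaugeBundle U hU hcov h hloc).TotalSpace))
    (one_mul (FiberBundleCore.fiberCoord _ y))
  mul_smul a b y := congrArg (fun f : F => (⟨y.1, f⟩ : (gaugeBundle U hU hcov h hloc).TotalSpace))
    (mul_assoc a b (FiberBundleCore.fiberCoord _ y))

theorem gaugeBundle_isQuotientCoveringMap :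
    IsQuotientCoveringMap (gaugeBundle U hU hcov h hloc).proj F := by
  set Z := gaugeBundle U hU hcov h hloc with hZ
  rw [isQuotientCoveringMap_iff_isCoveringMap_and]
  have : ∀ x, DiscreteTopology (Z.Fiber x) := fun x => ‹DiscreteTopology F›
  refine ⟨FiberBundle.isCoveringMap (F := F) (E := Z.Fiber), fun x => ⟨⟨x, (1 : F)⟩, rfl⟩, ?_, ?_, ?_⟩
  · constructor
    intro a
    rw [continuous_iff_continuousAt]
    intro y
    rw [FiberBundle.continuousAt_totalSpace]
    refine ⟨Z.continuous_proj.continuousAt, ?_⟩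
    have h1 : ContinuousAt (fun y' : Z.TotalSpace => (trivializationAt F Z.Fiber y.1 y').2) y :=
      ((FiberBundle.continuousAt_totalSpace F (f := fun y' : Z.TotalSpace => y')).mp
        continuousAt_id).2
    have h2 := (continuous_of_discreteTopology (f := fun g : F => a * g)).continuousAt.comp h1
    refine h2.congr (Filter.Eventually.of_forall fun y' => ?_)
    exact (mul_assoc a (Z.fiberCoord y') _).symm
  · constructor
    intro a b y hab
    have : a * Z.fiberCoord y = b * Z.fiberCoord y := congrArg Z.fiberCoord hab
    exact mul_right_cancel this
  · intro y₁ y₂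
    constructor
    · intro hy
      obtain ⟨x₁, f₁⟩ := y₁
      obtain ⟨x₂, f₂⟩ := y₂
      change x₁ = x₂ at hy
      subst hy
      let f₁' : F := f₁
      let f₂' : F := f₂
      refine ⟨f₁' * f₂'⁻¹, ?_⟩
      have : f₁' * f₂'⁻¹ * f₂' = f₁' := inv_mul_cancel_right _ _
      exact congrArg (fun f : F => (⟨x₁, f⟩ : Z.TotalSpace)) this
    · rintro ⟨a, rfl⟩
      rfl

end GaugeBundle

/-- If all local path classes are determined, up to a gauge, by a locally constant cocycle with
values in a free group, then the fundamental group is free. -/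
theorem isFreeGroup_fundamentalGroup_of_gauge {X ι F : Type*} [TopologicalSpace X] [Group F]
    [IsFreeGroup F] (U : ι → Set X) (hU : ∀ i, IsOpen (U i)) (hcov : ∀ x, ∃ i, x ∈ U i)
    (h : ι → X → F)
    (hloc : ∀ i j, ∀ p ∈ U i ∩ U j, ∀ᶠ q in 𝓝 p, h i q * (h j q)⁻¹ = h i p * (h j p)⁻¹)
    (x₀ : X) (ψ : F →* (FundamentalGroup X x₀)ᵐᵒᵖ)
    (B : ∀ (_ : ι) (p : X), Joined x₀ p → Path.Homotopic.Quotient x₀ p)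
    (hB : ∀ i (p q : X) (γ : Path p q), (∀ t, γ t ∈ U i) → ∀ h₁ h₂,
      (B i p h₁).trans (.mk γ) = B i q h₂)
    (hBB : ∀ i j, ∀ p ∈ U i ∩ U j, ∀ hp,
      B i p hp = (ψ (h i p * (h j p)⁻¹)).unop.toPath.trans (B j p hp)) :
    IsFreeGroup (FundamentalGroup X x₀) := by
  let _ : TopologicalSpace F := ⊥
  have : DiscreteTopology F := ⟨rfl⟩
  let Z := gaugeBundle U hU hcov h hloc
  have hp := gaugeBundle_isQuotientCoveringMap U hU hcov h hloc
  have hmul : ∀ (a b : F) (p : X) (c : Path.Homotopic.Quotient x₀ p),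
      (ψ (a * b)).unop.toPath.trans c =
        (ψ a).unop.toPath.trans ((ψ b).unop.toPath.trans c) := by
    intro a b p c
    rw [map_mul, ← Path.Homotopic.Quotient.trans_assoc]
    rfl
  -- The potential at a point of the covering is its fibre coordinate, pushed by `ψ`, followed by
  -- the path class of the preferred chart. By `hBB` the expression keeps its value on passing to
  -- another chart.
  have inj := hp.fundamentalGroupToMulOpposite_injective_of_parallel
    (⟨⟨x₀, (1 : F)⟩, rfl⟩ : Z.proj ⁻¹' {x₀})
    (fun y hy => (ψ (Z.fiberCoord y)).unop.toPath.trans (B (Z.indexAt y.1) y.1 hy)) (by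
      intro y
      let i := Z.indexAt y.1
      have h1 : ContinuousAt (fun y' : Z.TotalSpace => (trivializationAt F Z.Fiber y.1 y').2) y :=
        ((FiberBundle.continuousAt_totalSpace F (f := fun y' : Z.TotalSpace => y')).mp
          continuousAt_id).2
      -- Both sides are fibre coordinates in the fixed chart `i`, which are locally constant because
      -- `F` is discrete.
      have h2 : ∀ᶠ y' : Z.TotalSpace in 𝓝 y, Z.fiberCoord y' * (h (Z.indexAt y'.1) y'.1 * (h i y'.1)⁻¹) =
          (Z.fiberCoord y * (h (Z.indexAt y.1) y.1 * (h i y.1)⁻¹)) := by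
        have : {f : F | f = (trivializationAt F Z.Fiber y.1 y).2} ∈
            𝓝 (trivializationAt F Z.Fiber y.1 y).2 := mem_nhds_discrete.mpr rfl
        filter_upwards [h1 this] with y' hy'
        exact hy'
      have h3 : ∀ᶠ y' : Z.TotalSpace in 𝓝 y, y'.1 ∈ U i :=
        Z.continuous_proj.continuousAt ((hU i).mem_nhds (Z.mem_baseSet_at y.1))
      refine ⟨_, h2.and h3, ?_⟩
      intro y₁ y₂ Γ hΓ j₁ j₂
      have key : ∀ t, ∀ hJ, (ψ (Z.fiberCoord (Γ t))).unop.toPath.trans (B (Z.indexAt (Γ t).1) (Γ t).1 hJ) =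
          (ψ (Z.fiberCoord y * (h (Z.indexAt y.1) y.1 * (h i y.1)⁻¹))).unop.toPath.trans
            (B i (Γ t).1 hJ) := by
        intro t hJ
        rw [hBB (Z.indexAt (Γ t).1) i _ ⟨Z.mem_baseSet_at _, (hΓ t).2⟩, ← hmul, ← (hΓ t).1]
      have k0 := key 0
      have k1 := key 1
      rw [Γ.source] at k0
      rw [Γ.target] at k1
      rw [k0, k1, Path.Homotopic.Quotient.trans_assoc]
      congr 1
      exact hB i _ _ _ (fun t => (hΓ t).2) _ _)
  -- Monodromy lands in the opposite group; inversion turns it into a homomorphism to `F`. Its range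
  -- is free by Nielsen–Schreier.
  let φ := (MulEquiv.inv' F).symm.toMonoidHom.comp (hp.fundamentalGroupToMulOpposite
    (⟨⟨x₀, (1 : F)⟩, rfl⟩ : Z.proj ⁻¹' {x₀}))
  have hφ : Function.Injective φ := (MulEquiv.inv' F).symm.injective.comp inj
  exact IsFreeGroup.ofMulEquiv (MonoidHom.ofInjective hφ).symm

/-! ### Covers by open sets whose loops are null-homotopic -/

/-- Every loop that runs inside `U` is null-homotopic in the ambient space. -/
def LoopsNull {X : Type*} [TopologicalSpace X] (U : Set X) : Prop :=
  ∀ (p : X) (γ : Path p p), (∀ t, γ t ∈ U) → γ.Homotopic (Path.refl p)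

theorem LoopsNull.mk_eq_mk {X : Type*} [TopologicalSpace X] {U : Set X} (hU : LoopsNull U) {p q : X}
    (γ γ' : Path p q) (h : ∀ t, γ t ∈ U) (h' : ∀ t, γ' t ∈ U) :
    Path.Homotopic.Quotient.mk γ = .mk γ' := by
  have h1 := Path.Homotopic.Quotient.eq.mpr (hU p (γ.trans γ'.symm) (by
    intro t
    have : (γ.trans γ'.symm) t ∈ range (γ.trans γ'.symm) := ⟨t, rfl⟩
    rw [Path.trans_range] at this
    rcases this with ⟨s, hs⟩ | ⟨s, hs⟩
    · rw [← hs]; exact h s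
    · rw [← hs]; exact h' _))
  rw [Path.Homotopic.Quotient.mk_trans, Path.Homotopic.Quotient.mk_symm] at h1
  have h2 := congrArg (fun z => z.trans (Path.Homotopic.Quotient.mk γ')) h1
  simpa [Path.Homotopic.Quotient.trans_assoc] using h2

/-- Fix a representative of each path component of `U` and a path to it from `x₀`, then continue
inside `U`. By `LoopsNull.mk_eq_mk` the way chosen inside `U` does not matter. -/
theorem LoopsNull.exists_potential {X : Type*} [TopologicalSpace X] {U : Set X} (hU : LoopsNull U)
    (x₀ : X) : ∃ A : ∀ p, Joined x₀ p → Path.Homotopic.Quotient x₀ p,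
      ∀ (p q : X) (γ : Path p q), (∀ t, γ t ∈ U) → ∀ h₁ h₂, (A p h₁).trans (.mk γ) = A q h₂ := by
  classical
  let rep : U → U := fun p => Quotient.out (Quotient.mk (pathSetoid U) p)
  -- The representative `r` is a separate argument so that equal representatives of two points can
  -- be identified by substitution.
  let P : ∀ (r p : X), Path.Homotopic.Quotient x₀ p → Prop := fun r p ω =>
    ∃ (hr : Joined x₀ r) (β : Path r p), (∀ t, β t ∈ U) ∧ ω = Path.Homotopic.Quotient.trans
      (.mk hr.somePath) (.mk β)
  have uniq : ∀ r r' p ω ω', r = r' → P r p ω → P r' p ω' → ω = ω' := by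
    rintro r _ p _ _ rfl ⟨hr, β, hβ, rfl⟩ ⟨_, β', hβ', rfl⟩
    rw [hU.mk_eq_mk β β' hβ hβ']
  have ext : ∀ r p q ω (γ : Path p q), (∀ t, γ t ∈ U) → P r p ω → P r q (ω.trans (.mk γ)) := by
    rintro r p q _ γ hγ ⟨hr, β, hβ, rfl⟩
    refine ⟨hr, β.trans γ, ?_, ?_⟩
    · intro t
      have : (β.trans γ) t ∈ range (β.trans γ) := ⟨t, rfl⟩
      rw [Path.trans_range] at this
      rcases this with ⟨s, hs⟩ | ⟨s, hs⟩
      · rw [← hs]; exact hβ s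
      · rw [← hs]; exact hγ _
    · rw [Path.Homotopic.Quotient.mk_trans, Path.Homotopic.Quotient.trans_assoc]
  have exi : ∀ p : U, Joined x₀ p → ∃ ω, P (rep p) p ω := by
    intro p hp
    have hj : Joined (rep p) p := Quotient.exact (Quotient.out_eq (Quotient.mk (pathSetoid U) p))
    let β := hj.somePath.map continuous_subtype_val
    exact ⟨_, hp.trans ⟨β.symm⟩, β, fun t => (hj.somePath t).2, rfl⟩
  refine ⟨fun p hp => if h : p ∈ U then (exi ⟨p, h⟩ hp).choose else .mk hp.somePath, ?_⟩
  intro p q γ hγ h₁ h₂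
  have hpU : p ∈ U := by simpa using hγ 0
  have hqU : q ∈ U := by simpa using hγ 1
  simp only [hpU, hqU, dif_pos]
  have hrep : rep ⟨p, hpU⟩ = rep ⟨q, hqU⟩ := by
    have : Quotient.mk (pathSetoid U) ⟨p, hpU⟩ = Quotient.mk (pathSetoid U) ⟨q, hqU⟩ := by
      refine Quotient.sound ⟨⟨⟨fun t => ⟨γ t, hγ t⟩, by fun_prop⟩, ?_, ?_⟩⟩
      · exact Subtype.ext γ.source
      · exact Subtype.ext γ.target
    simp only [rep, this]
  exact uniq _ _ _ _ _ (congrArg Subtype.val hrep)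
    (ext _ _ _ _ γ hγ (exi ⟨p, hpU⟩ h₁).choose_spec) (exi ⟨q, hqU⟩ h₂).choose_spec

/-- A locally constant function on an open set of a locally path connected space: it suffices
that it is constant along the paths inside the set. -/
theorem eventually_eq_of_forall_path {X α : Type*} [TopologicalSpace X] [LocallyPathConnectedSpace X]
    {U : Set X} (hU : IsOpen U) (f : X → α)
    (hf : ∀ (p q : X) (γ : Path p q), (∀ t, γ t ∈ U) → f q = f p) :
    ∀ p ∈ U, ∀ᶠ q in 𝓝 p, f q = f p := by
  intro p hp
  filter_upwards [pathComponentIn_mem_nhds (hU.mem_nhds hp)] with q hq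
  obtain ⟨γ, hγ⟩ := hq
  exact hf p q γ hγ

open MulOpposite in
/-- Let a space be covered by three open sets whose loops are null-homotopic in the space.
If the first set meets the second in (at most) two connected pieces which are told apart by a set
that is relatively clopen in the intersection of the first set with the union of the others, then
the fundamental group is free. -/
theorem isFreeGroup_fundamentalGroup_of_three_sets {X : Type*} [TopologicalSpace X]
    [LocallyPathConnectedSpace X] {U₀ U₁ U₂ L : Set X} (hU₀ : IsOpen U₀) (hU₁ : IsOpen U₁)
    (hU₂ : IsOpen U₂) (hcov : ∀ x, x ∈ U₀ ∨ x ∈ U₁ ∨ x ∈ U₂) (n₀ : LoopsNull U₀)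
    (n₁ : LoopsNull U₁) (n₂ : LoopsNull U₂)
    (hL : ∀ p ∈ U₀ ∩ (U₁ ∪ U₂), ∀ᶠ q in 𝓝 p, (q ∈ L ↔ p ∈ L))
    (hleft : IsPreconnected (U₀ ∩ U₁ ∩ L)) (hright : IsPreconnected ((U₀ ∩ U₁) \ L)) (x₀ : X) :
    IsFreeGroup (FundamentalGroup X x₀) := by
  classical
  let U : Fin 3 → Set X := ![U₀, U₁, U₂]
  have hU : ∀ i, IsOpen (U i) := by intro i; fin_cases i <;> assumption
  have hnull : ∀ i, LoopsNull (U i) := by intro i; fin_cases i <;> assumption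
  have hcov' : ∀ x, ∃ i, x ∈ U i := by
    intro x
    rcases hcov x with h | h | h
    exacts [⟨0, h⟩, ⟨1, h⟩, ⟨2, h⟩]
  choose A hA using fun i => (hnull i).exists_potential x₀
  let S : Set X := (U₀ ∪ U₁) ∩ U₂
  have hS : IsOpen S := (hU₀.union hU₁).inter hU₂
  -- the universal cocycle
  let c : Fin 3 → Fin 3 → X → (FundamentalGroup X x₀)ᵐᵒᵖ := fun i j p =>
    if hp : Joined x₀ p then op (.fromPath ((A i p hp).trans (A j p hp).symm)) else 1
  have mulTrans : ∀ (a b : (FundamentalGroup X x₀)ᵐᵒᵖ) (p : X) (ω : Path.Homotopic.Quotient x₀ p),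
      (a * b).unop.toPath.trans ω = a.unop.toPath.trans (b.unop.toPath.trans ω) := by
    intro a b p ω
    rw [← Path.Homotopic.Quotient.trans_assoc]
    rfl
  have cA : ∀ i j p hp, A i p hp = (c i j p).unop.toPath.trans (A j p hp) := by
    intro i j p hp
    have : c i j p = op (.fromPath ((A i p hp).trans (A j p hp).symm)) := dif_pos hp
    rw [this]
    change _ = ((A i p hp).trans (A j p hp).symm).trans (A j p hp)
    rw [Path.Homotopic.Quotient.trans_assoc, Path.Homotopic.Quotient.symm_trans,
      Path.Homotopic.Quotient.trans_refl]
  have cmul : ∀ i j k p, c i j p * c j k p = c i k p := by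
    intro i j k p
    by_cases hp : Joined x₀ p
    · have e : ∀ i j, c i j p = op (.fromPath ((A i p hp).trans (A j p hp).symm)) :=
        fun i j => dif_pos hp
      rw [e, e, e, ← op_mul, FundamentalGroup.mul_def]
      congr 1
      change ((A i p hp).trans (A j p hp).symm).trans ((A j p hp).trans (A k p hp).symm) = _
      rw [Path.Homotopic.Quotient.trans_assoc, ← Path.Homotopic.Quotient.trans_assoc _ (A j p hp),
        Path.Homotopic.Quotient.symm_trans, Path.Homotopic.Quotient.refl_trans]
    · have e : ∀ i j, c i j p = 1 := fun i j => dif_neg hp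
      rw [e, e, e, one_mul]
  have cself : ∀ i p, c i i p = 1 := fun i p => by
    have := cmul i i i p
    exact mul_eq_left.mp this
  have cinv : ∀ i j p, c j i p = (c i j p)⁻¹ := fun i j p => by
    rw [eq_inv_iff_mul_eq_one, cmul, cself]
  have cloc : ∀ i j, ∀ p ∈ U i ∩ U j, ∀ᶠ q in 𝓝 p, c i j q = c i j p := by
    intro i j
    refine eventually_eq_of_forall_path ((hU i).inter (hU j)) _ ?_
    intro p q γ hγ
    by_cases hp : Joined x₀ p
    · have hq : Joined x₀ q := hp.trans ⟨γ⟩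
      have e : c i j p = op (.fromPath ((A i p hp).trans (A j p hp).symm)) := dif_pos hp
      have e' : c i j q = op (.fromPath ((A i q hq).trans (A j q hq).symm)) := dif_pos hq
      rw [e, e']
      congr 1
      have h1 := hA i p q γ (fun t => (hγ t).1) hp hq
      have h2 := hA j p q γ (fun t => (hγ t).2) hp hq
      have h3 : (Path.Homotopic.Quotient.mk γ).trans (A j q hq).symm = (A j p hp).symm := by
        have := congrArg (fun z => (A j p hp).symm.trans (z.trans (A j q hq).symm)) h2
        simpa [← Path.Homotopic.Quotient.trans_assoc] using this
      rw [← h1, Path.Homotopic.Quotient.trans_assoc, h3]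
    · have hq : ¬ Joined x₀ q := fun hq => hp (hq.trans ⟨γ.symm⟩)
      have e : c i j p = 1 := dif_neg hp
      have e' : c i j q = 1 := dif_neg hq
      rw [e, e']
  -- the values on the two pieces
  let _ : TopologicalSpace (FundamentalGroup X x₀)ᵐᵒᵖ := ⊥
  have : DiscreteTopology (FundamentalGroup X x₀)ᵐᵒᵖ := ⟨rfl⟩
  have cont_of_loc : ∀ (s : Set X) (f : X → (FundamentalGroup X x₀)ᵐᵒᵖ), (∀ p ∈ s, ∀ᶠ q in 𝓝 p, f q = f p) →
      ContinuousOn f s := fun s f hf p hp =>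
    (continuousAt_const.congr ((hf p hp).mono fun _ h => h.symm)).continuousWithinAt
  have c01 : ContinuousOn (c 0 1) (U₀ ∩ U₁) := cont_of_loc _ _ (cloc 0 1)
  -- A locally constant function has one value on each of the two preconnected pieces: `a₁` on the
  -- right and `ζ * a₁` on the left. An empty piece gets an arbitrary value.
  obtain ⟨a₁, ha₁⟩ : ∃ a₁, ∀ p ∈ (U₀ ∩ U₁) \ L, c 0 1 p = a₁ := by
    by_cases hne : ((U₀ ∩ U₁) \ L).Nonempty
    · obtain ⟨r, hr⟩ := hne
      exact ⟨_, fun p hp => hright.constant (c01.mono sdiff_subset) hp hr⟩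
    · exact ⟨1, fun p hp => (hne ⟨p, hp⟩).elim⟩
  obtain ⟨ζ, hζ⟩ : ∃ ζ, ∀ p ∈ U₀ ∩ U₁ ∩ L, c 0 1 p = ζ * a₁ := by
    by_cases hne : (U₀ ∩ U₁ ∩ L).Nonempty
    · obtain ⟨r, hr⟩ := hne
      refine ⟨c 0 1 r * a₁⁻¹, fun p hp => ?_⟩
      rw [inv_mul_cancel_right]
      exact hleft.constant (c01.mono inter_subset_left) hp hr
    · exact ⟨1, fun p hp => (hne ⟨p, hp⟩).elim⟩
  -- The normalised `c 0 1`, extended by means of `L` to where `U₀` meets `U₂`.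
  let b' : X → (FundamentalGroup X x₀)ᵐᵒᵖ := fun p => if p ∈ L then ζ else 1
  have hb' : ∀ p ∈ U₀ ∩ U₁, c 0 1 p = b' p * a₁ := by
    intro p hp
    by_cases hpL : p ∈ L
    · simpa [b', hpL] using hζ p ⟨hp, hpL⟩
    · simpa [b', hpL] using ha₁ p ⟨hp, hpL⟩
  -- Both formulas agree on `U₀ ∩ U₁` by the cocycle relation, so this is a single locally constant
  -- function on `S` from which `c 1 2` and `c 0 2` are recovered.
  let D : X → (FundamentalGroup X x₀)ᵐᵒᵖ := fun p => if p ∈ U₁ then a₁ * c 1 2 p else (b' p)⁻¹ * c 0 2 p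
  have hD0 : ∀ p ∈ U₀, D p = (b' p)⁻¹ * c 0 2 p := by
    intro p hp
    by_cases hp1 : p ∈ U₁
    · simp only [D, hp1, if_true]
      rw [← cmul 0 1 2, hb' p ⟨hp, hp1⟩]
      group
    · simp [D, hp1]
  have hD1 : ∀ p ∈ U₁, D p = a₁ * c 1 2 p := by
    intro p hp1
    simp [D, hp1]
  have b'loc : ∀ p ∈ U₀ ∩ (U₁ ∪ U₂), ∀ᶠ q in 𝓝 p, b' q = b' p := by
    intro p hp
    filter_upwards [hL p hp] with q hq
    simp [b', hq]
  have Dloc : ∀ p ∈ S, ∀ᶠ q in 𝓝 p, D q = D p := by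
    rintro p ⟨hp | hp, hp2⟩
    · filter_upwards [hU₀.mem_nhds hp, cloc 0 2 p ⟨hp, hp2⟩, b'loc p ⟨hp, Or.inr hp2⟩] with q h1 h2 h3
      rw [hD0 q h1, hD0 p hp, h2, h3]
    · filter_upwards [hU₁.mem_nhds hp, cloc 1 2 p ⟨hp, hp2⟩] with q h1 h2
      rw [hD1 q h1, hD1 p hp, h2]
  have Dcont : Continuous fun p : S => D p := (cont_of_loc S D Dloc).domRestrict
  -- the free group
  have : LocallyConnectedSpace S := by
    have := hS.locallyPathConnectedSpace
    infer_instance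
  -- The letter `none` stands for the left piece; each component of `S` has its own letter, sent to
  -- the constant value of `D` there.
  let ψ : FreeGroup (Option (ConnectedComponents S)) →* (FundamentalGroup X x₀)ᵐᵒᵖ := FreeGroup.lift fun o => o.elim ζ fun κ => D (Quotient.out κ : S)
  let b : X → FreeGroup (Option (ConnectedComponents S)) := fun p => if p ∈ L then FreeGroup.of none else 1
  let k : X → FreeGroup (Option (ConnectedComponents S)) := fun p => if hp : p ∈ S then FreeGroup.of (some (⟨p, hp⟩ : S)) else 1
  have hψb : ∀ p, ψ (b p) = b' p := by
    intro p
    by_cases hp : p ∈ L <;> simp [b, b', hp, ψ]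
  have hψk : ∀ p ∈ S, ψ (k p) = D p := by
    intro p hp
    simp only [k, hp, dif_pos, ψ, FreeGroup.lift_apply_of, Option.elim]
    set s : S := ⟨p, hp⟩
    have h1 : ((Quotient.out (s : ConnectedComponents S) : S) : ConnectedComponents S) = (s : ConnectedComponents S) := Quotient.out_eq _
    have h2 : Quotient.out (s : ConnectedComponents S) ∈ connectedComponent s := by
      rw [← ConnectedComponents.coe_eq_coe.mp h1]
      exact mem_connectedComponent
    exact isPreconnected_connectedComponent.constant Dcont.continuousOn h2 mem_connectedComponent
  have bloc : ∀ p ∈ U₀ ∩ (U₁ ∪ U₂), ∀ᶠ q in 𝓝 p, b q = b p := by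
    intro p hp
    filter_upwards [hL p hp] with q hq
    simp [b, hq]
  have kloc : ∀ p ∈ S, ∀ᶠ q in 𝓝 p, k q = k p := by
    intro p hp
    -- Components of `S` are open by local connectedness, hence `k` is locally constant on `S`.
    have hopen : IsOpen (Subtype.val '' connectedComponent (⟨p, hp⟩ : S)) :=
      hS.isOpenMap_subtype_val _ isOpen_connectedComponent
    filter_upwards [hopen.mem_nhds ⟨⟨p, hp⟩, mem_connectedComponent, rfl⟩] with q hq
    obtain ⟨⟨q, hq⟩, hqc, rfl⟩ := hq
    simp only [k, hp, hq, dif_pos]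
    congr 2
    exact ConnectedComponents.coe_eq_coe'.mpr hqc
  -- Only the quotients on overlaps need be locally constant: they are `b`, `b * k` and `k` for the
  -- pairs 01, 02 and 12. Under `ψ` they become the cocycle `c` in the gauge `a`.
  let h : Fin 3 → X → FreeGroup (Option (ConnectedComponents S)) := ![fun p => b p * k p, fun p => k p, fun _ => 1]
  let a : Fin 3 → (FundamentalGroup X x₀)ᵐᵒᵖ := ![1, a₁, 1]
  have hhloc : ∀ i j, ∀ p ∈ U i ∩ U j, ∀ᶠ q in 𝓝 p, h i q * (h j q)⁻¹ = h i p * (h j p)⁻¹ := by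
    have symm : ∀ i j, (∀ p ∈ U i ∩ U j, ∀ᶠ q in 𝓝 p, h i q * (h j q)⁻¹ = h i p * (h j p)⁻¹) →
        ∀ p ∈ U j ∩ U i, ∀ᶠ q in 𝓝 p, h j q * (h i q)⁻¹ = h j p * (h i p)⁻¹ := by
      intro i j H p hp
      filter_upwards [H p hp.symm] with q hq
      simpa using congrArg (·⁻¹) hq
    have e01 : ∀ p ∈ U 0 ∩ U 1, ∀ᶠ q in 𝓝 p, h 0 q * (h 1 q)⁻¹ = h 0 p * (h 1 p)⁻¹ := by
      rintro p ⟨h0, h1⟩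
      filter_upwards [bloc p ⟨h0, Or.inl h1⟩] with q hq
      simp [h, hq]
    have e02 : ∀ p ∈ U 0 ∩ U 2, ∀ᶠ q in 𝓝 p, h 0 q * (h 2 q)⁻¹ = h 0 p * (h 2 p)⁻¹ := by
      rintro p ⟨h0, h2⟩
      filter_upwards [bloc p ⟨h0, Or.inr h2⟩, kloc p ⟨Or.inl h0, h2⟩] with q hq hq'
      simp [h, hq, hq']
    have e12 : ∀ p ∈ U 1 ∩ U 2, ∀ᶠ q in 𝓝 p, h 1 q * (h 2 q)⁻¹ = h 1 p * (h 2 p)⁻¹ := by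
      rintro p ⟨h1, h2⟩
      filter_upwards [kloc p ⟨Or.inr h1, h2⟩] with q hq'
      simp [h, hq']
    have es : ∀ i, ∀ p ∈ U i ∩ U i, ∀ᶠ q in 𝓝 p, h i q * (h i q)⁻¹ = h i p * (h i p)⁻¹ := by
      intro i p _
      filter_upwards with q
      rw [mul_inv_cancel, mul_inv_cancel]
    intro i j
    fin_cases i <;> fin_cases j
    exacts [es 0, e01, e02, symm _ _ e01, es 1, e12, symm _ _ e02, symm _ _ e12, es 2]
  have hgauge : ∀ i j, ∀ p ∈ U i ∩ U j, a i * c i j p = ψ (h i p * (h j p)⁻¹) * a j := by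
    have symm : ∀ i j, (∀ p ∈ U i ∩ U j, a i * c i j p = ψ (h i p * (h j p)⁻¹) * a j) →
        ∀ p ∈ U j ∩ U i, a j * c j i p = ψ (h j p * (h i p)⁻¹) * a i := by
      intro i j H p hp
      have := H p hp.symm
      rw [cinv i j, mul_inv_eq_iff_eq_mul, mul_assoc, this, ← mul_assoc, ← map_mul]
      simp
    have e01 : ∀ p ∈ U 0 ∩ U 1, a 0 * c 0 1 p = ψ (h 0 p * (h 1 p)⁻¹) * a 1 := by
      intro p hp
      simpa [a, h, hψb] using hb' p hp
    have e02 : ∀ p ∈ U 0 ∩ U 2, a 0 * c 0 2 p = ψ (h 0 p * (h 2 p)⁻¹) * a 2 := by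
      rintro p ⟨h0, h2⟩
      simp [a, h, hψb, hψk p ⟨Or.inl h0, h2⟩, hD0 p h0]
    have e12 : ∀ p ∈ U 1 ∩ U 2, a 1 * c 1 2 p = ψ (h 1 p * (h 2 p)⁻¹) * a 2 := by
      rintro p ⟨h1, h2⟩
      simp [a, h, hψk p ⟨Or.inr h1, h2⟩, hD1 p h1]
    have es : ∀ i, ∀ p ∈ U i ∩ U i, a i * c i i p = ψ (h i p * (h i p)⁻¹) * a i := by
      intro i p _
      simp [cself]
    intro i j
    fin_cases i <;> fin_cases j
    exacts [es 0, e01, e02, symm _ _ e01, es 1, e12, symm _ _ e02, symm _ _ e12, es 2]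
  refine isFreeGroup_fundamentalGroup_of_gauge U hU hcov' h hhloc x₀ ψ
    (fun i p hp => (a i).unop.toPath.trans (A i p hp)) ?_ ?_
  · intro i p q γ hγ h₁ h₂
    rw [Path.Homotopic.Quotient.trans_assoc, hA i p q γ hγ h₁ h₂]
  · intro i j p hp hJ
    rw [cA i j p hJ, ← mulTrans, ← mulTrans, hgauge i j p hp]

/-! ### Coordinates on the circle -/

/-- The representative of a point of the circle in `[0, 1)`. -/
noncomputable def cutCoord (z : UnitAddCircle) : ℝ := AddCircle.equivIco 1 0 z

/-- The representative of a point of the circle in `[-1/2, 1/2)`. -/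
noncomputable def arcCoord (z : UnitAddCircle) : ℝ := AddCircle.equivIco 1 (-(1 / 2)) z

@[simp] theorem coe_cutCoord (z : UnitAddCircle) : (cutCoord z : UnitAddCircle) = z :=
  AddCircle.coe_equivIco

@[simp] theorem coe_arcCoord (z : UnitAddCircle) : (arcCoord z : UnitAddCircle) = z :=
  AddCircle.coe_equivIco

theorem cutCoord_nonneg (z : UnitAddCircle) : 0 ≤ cutCoord z := (AddCircle.equivIco 1 0 z).2.1

theorem cutCoord_lt_one (z : UnitAddCircle) : cutCoord z < 1 :=
  (AddCircle.equivIco 1 0 z).2.2.trans_eq (zero_add 1)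

theorem cutCoord_coe {t : ℝ} (h0 : 0 ≤ t) (h1 : t < 1) : cutCoord (t : UnitAddCircle) = t :=
  congrArg Subtype.val (AddCircle.equivIco_coe_eq (p := (1 : ℝ)) (a := 0) ⟨h0, by simpa using h1⟩)

theorem arcCoord_coe {t : ℝ} (h0 : -(1 / 2) ≤ t) (h1 : t < 1 / 2) :
    arcCoord (t : UnitAddCircle) = t :=
  congrArg Subtype.val
    (AddCircle.equivIco_coe_eq (p := (1 : ℝ)) (a := -(1 / 2)) ⟨h0, by linarith⟩)

theorem neg_half_le_arcCoord (z : UnitAddCircle) : -(1 / 2) ≤ arcCoord z :=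
  (AddCircle.equivIco 1 (-(1 / 2)) z).2.1

theorem arcCoord_lt_half (z : UnitAddCircle) : arcCoord z < 1 / 2 := by
  have := (AddCircle.equivIco 1 (-(1 / 2)) z).2.2
  unfold arcCoord
  linarith

theorem cutCoord_injective : Function.Injective cutCoord := fun a b h => by
  rw [← coe_cutCoord a, ← coe_cutCoord b, h]

theorem cutCoord_eq_zero_iff {z : UnitAddCircle} : cutCoord z = 0 ↔ z = 0 := by
  constructor
  · intro h
    rw [← coe_cutCoord z, h]
    rfl
  · rintro rfl
    exact cutCoord_coe (t := 0) le_rfl one_pos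

theorem cutCoord_pos {z : UnitAddCircle} (hz : z ≠ 0) : 0 < cutCoord z :=
  lt_of_le_of_ne (cutCoord_nonneg z) fun h => hz (cutCoord_eq_zero_iff.mp h.symm)

theorem norm_eq_abs_arcCoord (z : UnitAddCircle) : ‖z‖ = |arcCoord z| := by
  conv_lhs => rw [← coe_arcCoord z]
  rw [AddCircle.norm_coe_eq_abs_iff 1 one_ne_zero, abs_one, abs_le]
  exact ⟨neg_half_le_arcCoord z, (arcCoord_lt_half z).le⟩

theorem cutCoord_of_arcCoord_nonneg {z : UnitAddCircle} (h : 0 ≤ arcCoord z) :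
    cutCoord z = arcCoord z := by
  conv_lhs => rw [← coe_arcCoord z]
  exact cutCoord_coe h (by linarith [arcCoord_lt_half z])

theorem cutCoord_of_arcCoord_neg {z : UnitAddCircle} (h : arcCoord z < 0) :
    cutCoord z = 1 + arcCoord z := by
  have : ((1 + arcCoord z : ℝ) : UnitAddCircle) = z := by
    rw [AddCircle.coe_add, coe_arcCoord, AddCircle.coe_period, zero_add]
  conv_lhs => rw [← this]
  exact cutCoord_coe (by linarith [neg_half_le_arcCoord z]) (by linarith)

theorem norm_eq_min_cutCoord (z : UnitAddCircle) : ‖z‖ = min (cutCoord z) (1 - cutCoord z) := by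
  rw [norm_eq_abs_arcCoord]
  rcases le_or_gt 0 (arcCoord z) with h | h
  · rw [cutCoord_of_arcCoord_nonneg h, abs_of_nonneg h, min_eq_left]
    linarith [arcCoord_lt_half z]
  · rw [cutCoord_of_arcCoord_neg h, abs_of_neg h, min_eq_right]
    · ring
    · linarith [neg_half_le_arcCoord z]

theorem continuousAt_cutCoord {z : UnitAddCircle} (hz : z ≠ 0) : ContinuousAt cutCoord z :=
  continuousAt_subtype_val.comp (AddCircle.continuousAt_equivIco 1 0 (by simpa using hz))

theorem continuousAt_arcCoord {z : UnitAddCircle} (hz : ‖z‖ < 1 / 2) : ContinuousAt arcCoord z := by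
  refine continuousAt_subtype_val.comp (AddCircle.continuousAt_equivIco 1 (-(1 / 2)) ?_)
  rintro rfl
  rw [(AddCircle.norm_coe_eq_abs_iff 1 one_ne_zero).mpr (by norm_num)] at hz
  norm_num at hz

/-! ### A circle with rays -/

/-- The circle with a ray (a copy of `[0, 1]`) attached at `v r` for each `r`. A point is given by
its position on the circle and by its depths along the rays. -/
def RayedCircle {R : Type} (v : R → UnitAddCircle) : Type :=
  {x : UnitAddCircle × (R → ℝ) // (∀ r, 0 ≤ x.2 r ∧ x.2 r ≤ 1) ∧
    ∀ r, x.2 r ≠ 0 → x.1 = v r ∧ ∀ s, x.2 s ≠ 0 → s = r}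

namespace RayedCircle

variable {R : Type} {v : R → UnitAddCircle}

instance : TopologicalSpace (RayedCircle v) := instTopologicalSpaceSubtype

instance : T2Space (RayedCircle v) := inferInstanceAs (T2Space (Subtype _))

/-- The position on the circle below a point. -/
def angle (x : RayedCircle v) : UnitAddCircle := x.1.1

/-- The depth of a point along a ray. -/
def depth (x : RayedCircle v) (r : R) : ℝ := x.1.2 r

@[fun_prop] theorem continuous_angle : Continuous (angle : RayedCircle v → _) :=
  continuous_fst.comp continuous_subtype_val

@[fun_prop] theorem continuous_depth (r : R) : Continuous fun x : RayedCircle v => x.depth r :=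
  (continuous_apply r).comp (continuous_snd.comp continuous_subtype_val)

theorem continuous_iff' {Y : Type*} [TopologicalSpace Y] {f : Y → RayedCircle v} :
    Continuous f ↔ Continuous (fun y => (f y).angle) ∧ ∀ r, Continuous fun y => (f y).depth r := by
  constructor
  · intro h
    exact ⟨continuous_angle.comp h, fun r => (continuous_depth r).comp h⟩
  · rintro ⟨h1, h2⟩
    exact Continuous.subtype_mk (h1.prodMk (continuous_pi h2)) _

@[ext] theorem ext' {x y : RayedCircle v} (h1 : x.angle = y.angle)
    (h2 : ∀ r, x.depth r = y.depth r) : x = y :=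
  Subtype.ext (Prod.ext h1 (funext h2))

theorem depth_nonneg (x : RayedCircle v) (r : R) : 0 ≤ x.depth r := (x.2.1 r).1
theorem depth_le_one (x : RayedCircle v) (r : R) : x.depth r ≤ 1 := (x.2.1 r).2
theorem angle_eq_of_depth {x : RayedCircle v} {r : R} (h : x.depth r ≠ 0) : x.angle = v r :=
  (x.2.2 r h).1
theorem eq_of_depth {x : RayedCircle v} {r s : R} (h : x.depth r ≠ 0) (h' : x.depth s ≠ 0) :
    s = r := (x.2.2 r h).2 s h'

theorem depth_eq_zero {x : RayedCircle v} {r s : R} (h : x.depth r ≠ 0) (hs : s ≠ r) :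
    x.depth s = 0 := by
  by_contra h'
  exact hs (eq_of_depth h h')

/-- The point of the circle itself at a given position. -/
def circlePt (z : UnitAddCircle) : RayedCircle v := ⟨(z, fun _ => 0), by simp⟩

@[simp] theorem angle_circlePt (z : UnitAddCircle) : (circlePt z : RayedCircle v).angle = z := rfl
@[simp] theorem depth_circlePt (z : UnitAddCircle) (r : R) :
    (circlePt z : RayedCircle v).depth r = 0 := rfl

open Classical in
/-- The point of a ray at a given depth (clamped to `[0, 1]`). -/
noncomputable def rayPt (r : R) (a : ℝ) : RayedCircle v :=
  ⟨(v r, fun s => if s = r then max 0 (min a 1) else 0), by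
    constructor
    · intro s
      by_cases h : s = r <;> simp [h]
    · intro s hs
      have : s = r := by
        by_contra h
        simp [h] at hs
      subst this
      refine ⟨rfl, fun t ht => ?_⟩
      by_contra h
      simp [h] at ht⟩

@[simp] theorem angle_rayPt (r : R) (a : ℝ) : (rayPt r a : RayedCircle v).angle = v r := rfl

theorem depth_rayPt {r : R} {a : ℝ} (h0 : 0 ≤ a) (h1 : a ≤ 1) :
    (rayPt r a : RayedCircle v).depth r = a := by
  simp [rayPt, depth, h0, h1]

theorem depth_rayPt_of_ne {r s : R} (a : ℝ) (h : s ≠ r) :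
    (rayPt r a : RayedCircle v).depth s = 0 := by
  simp [rayPt, depth, h]

theorem rayPt_depth {x : RayedCircle v} {r : R} (h : x.depth r ≠ 0) : rayPt r (x.depth r) = x := by
  refine ext' ?_ fun s => ?_
  · rw [angle_rayPt, angle_eq_of_depth h]
  · by_cases hs : s = r
    · subst hs
      rw [depth_rayPt (x.depth_nonneg _) (x.depth_le_one _)]
    · rw [depth_rayPt_of_ne _ hs, depth_eq_zero h hs]

theorem continuous_circlePt : Continuous (circlePt : UnitAddCircle → RayedCircle v) := by
  rw [continuous_iff']
  exact ⟨continuous_id, fun _ => continuous_const⟩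

theorem continuous_rayPt (r : R) : Continuous (rayPt r : ℝ → RayedCircle v) := by
  rw [continuous_iff']
  refine ⟨continuous_const, fun s => ?_⟩
  by_cases h : s = r
  · subst h
    simp only [rayPt, depth, if_true]
    fun_prop
  · simp only [depth_rayPt_of_ne _ h]
    fun_prop

/-- Multiply all depths by a factor. -/
def scale (τ : unitInterval) (x : RayedCircle v) : RayedCircle v :=
  ⟨(x.angle, fun r => τ * x.depth r), by
    constructor
    · intro r
      exact ⟨mul_nonneg τ.2.1 (x.depth_nonneg r),
        mul_le_one₀ τ.2.2 (x.depth_nonneg r) (x.depth_le_one r)⟩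
    · intro r hr
      have := right_ne_zero_of_mul hr
      exact ⟨angle_eq_of_depth this, fun s hs => eq_of_depth this (right_ne_zero_of_mul hs)⟩⟩

@[simp] theorem angle_scale (τ : unitInterval) (x : RayedCircle v) : (scale τ x).angle = x.angle :=
  rfl
@[simp] theorem depth_scale (τ : unitInterval) (x : RayedCircle v) (r : R) :
    (scale τ x).depth r = τ * x.depth r := rfl

theorem scale_one (x : RayedCircle v) : scale 1 x = x := by ext <;> simp
theorem scale_zero (x : RayedCircle v) : scale 0 x = circlePt x.angle := by ext <;> simp

theorem continuous_scale : Continuous fun p : unitInterval × RayedCircle v => scale p.1 p.2 := by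
  rw [continuous_iff']
  simp only [depth_scale, angle_scale]
  exact ⟨by fun_prop, fun r => by fun_prop⟩

theorem eq_circlePt_or_exists_depth (x : RayedCircle v) :
    x = circlePt x.angle ∨ ∃ r, 0 < x.depth r := by
  by_cases h : ∃ r, x.depth r ≠ 0
  · obtain ⟨r, hr⟩ := h
    exact Or.inr ⟨r, lt_of_le_of_ne (x.depth_nonneg r) hr.symm⟩
  · push Not at h
    exact Or.inl (ext' rfl h)

variable [Fintype R]

open Classical in
/-- The distance of a point from the point `μ` of the circle, provided that it is close to `μ`. -/
noncomputable def radius (μ : UnitAddCircle) (x : RayedCircle v) : ℝ :=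
  ‖x.angle - μ‖ + ∑ r, if v r = μ then x.depth r else 0

theorem continuous_radius (μ : UnitAddCircle) :
    Continuous (radius μ : RayedCircle v → ℝ) := by
  unfold radius
  refine Continuous.add (by fun_prop) (continuous_finsetSum _ fun r _ => ?_)
  split_ifs <;> fun_prop

/-- A point that is not over `μ` has no depth on the rays at `μ`. -/
theorem radius_of_angle_ne {μ : UnitAddCircle} {x : RayedCircle v} (h : x.angle ≠ μ) :
    radius μ x = ‖x.angle - μ‖ := by
  rw [radius, add_eq_left]
  refine Finset.sum_eq_zero fun r _ => ?_
  split_ifs with hr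
  · by_contra h'
    exact h ((angle_eq_of_depth h').trans hr)
  · rfl

theorem radius_of_depth {x : RayedCircle v} {r : R} (h : x.depth r ≠ 0) :
    radius (v r) x = x.depth r := by
  rw [radius, angle_eq_of_depth h, sub_self, norm_zero, zero_add, Finset.sum_eq_single r]
  · simp
  · intro s _ hs
    simp [depth_eq_zero h hs]
  · simp

theorem radius_circlePt (μ z : UnitAddCircle) :
    radius μ (circlePt z : RayedCircle v) = ‖z - μ‖ := by
  simp [radius]

theorem radius_scale_le (μ : UnitAddCircle) (τ : unitInterval) (x : RayedCircle v) :
    radius μ (scale τ x) ≤ radius μ x := by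
  unfold radius
  rw [angle_scale]
  gcongr with r _
  split_ifs
  · rw [depth_scale]
    exact mul_le_of_le_one_left (x.depth_nonneg r) τ.2.2
  · rfl

theorem norm_le_radius (μ : UnitAddCircle) (x : RayedCircle v) :
    ‖x.angle - μ‖ ≤ radius μ x := by
  refine le_add_of_nonneg_right (Finset.sum_nonneg fun r _ => ?_)
  split_ifs
  exacts [x.depth_nonneg r, le_rfl]

theorem radius_scale_of_angle_ne {μ : UnitAddCircle} (τ : unitInterval) {x : RayedCircle v}
    (h : x.angle ≠ μ) : radius μ (scale τ x) = radius μ x := by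
  rw [radius_of_angle_ne h, radius_of_angle_ne (by simpa using h), angle_scale]

end RayedCircle

/-! ### Patterns of three particles and their contractibility -/

namespace RayedCircle

/-- The three kinds of places for a particle relative to a centre `μ` on the circle: off the centre,
near the centre, or on a ray at the centre. -/
inductive Slot (R : Type)
  | cut : Slot R
  | arc : Slot R
  | ray (r : R) : Slot R

variable {R : Type} {v : R → UnitAddCircle}

/-- The condition that a particle is at a place of the given kind. -/
def Slot.Mem (ε : ℝ) (μ : UnitAddCircle) : Slot R → RayedCircle v → Prop
  | .cut, x => x.angle ≠ μ
  | .arc, x => ‖x.angle - μ‖ < ε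
  | .ray r, x => v r = μ ∧ 0 < x.depth r

/-- The coordinate of a particle at a place of the given kind. -/
noncomputable def Slot.coord (μ : UnitAddCircle) : Slot R → RayedCircle v → ℝ
  | .cut, x => cutCoord (x.angle - μ)
  | .arc, x => arcCoord (x.angle - μ)
  | .ray r, x => x.depth r

/-- The standard point with a given coordinate. -/
noncomputable def Slot.pt (μ : UnitAddCircle) : Slot R → ℝ → RayedCircle v
  | .cut, t => circlePt (μ + t)
  | .arc, t => circlePt (μ + t)
  | .ray r, t => rayPt r t

/-- The contraction of a place to its standard points. -/
def Slot.shrink : Slot R → unitInterval → RayedCircle v → RayedCircle v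
  | .cut, τ, x => scale τ x
  | .arc, τ, x => scale τ x
  | .ray _, _, x => x

/-- The range of the coordinate. -/
def Slot.Range (v : R → UnitAddCircle) (ε : ℝ) (μ : UnitAddCircle) : Slot R → ℝ → Prop
  | .cut, t => 0 < t ∧ t < 1
  | .arc, t => -ε < t ∧ t < ε
  | .ray r, t => v r = μ ∧ 0 < t ∧ t ≤ 1

/-- The relative position of two particles in a pattern. -/
def Slot.Rel [Fintype R] [LinearOrder R] (μ : UnitAddCircle) :
    Slot R → Slot R → RayedCircle v → RayedCircle v → Prop
  | .cut, .cut, x, y => cutCoord (x.angle - μ) < cutCoord (y.angle - μ)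
  | .cut, .ray _, _, _ => True
  | .arc, .cut, x, y => radius μ x < radius μ y
  | .arc, .ray _, x, y => radius μ x < radius μ y
  | .ray r, .ray s, x, y => r < s ∨ r = s ∧ x.depth r < y.depth s
  -- The excluded cases force the order in a pattern: at most one `arc`, in front, then the `cut`
  -- places, then the rays.
  | _, _, _, _ => False

/-- The relative position of two particles in terms of coordinates. -/
def Slot.CoordRel [LinearOrder R] : Slot R → Slot R → ℝ → ℝ → Prop
  | .cut, .cut, t, t' => t < t'
  | .cut, .ray _, _, _ => True
  -- This says `|t| < min t' (1 - t')`, split into linear inequalities for the sake of convexity.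
  | .arc, .cut, t, t' => (t < t' ∧ -t < t') ∧ t < 1 - t' ∧ -t < 1 - t'
  | .arc, .ray _, t, t' => t < t' ∧ -t < t'
  | .ray r, .ray s, t, t' => r < s ∨ r = s ∧ t < t'
  | _, _, _, _ => False

variable {ε : ℝ} {μ : UnitAddCircle}

theorem Slot.range_coord {s : Slot R} {x : RayedCircle v} (h : s.Mem ε μ x) :
    s.Range v ε μ (s.coord μ x) := by
  cases s with
  | cut => exact ⟨cutCoord_pos (sub_ne_zero.mpr h), cutCoord_lt_one _⟩
  | arc =>
    have h' : ‖x.angle - μ‖ < ε := h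
    rw [norm_eq_abs_arcCoord, abs_lt] at h'
    exact h'
  | ray r => exact ⟨h.1, h.2, x.depth_le_one r⟩

theorem Slot.mem_pt (hε : ε ≤ 1 / 4) {s : Slot R} {t : ℝ} (h : s.Range v ε μ t) :
    s.Mem ε μ (s.pt μ t : RayedCircle v) := by
  cases s with
  | cut =>
    intro h'
    have h2 : ((t : ℝ) : UnitAddCircle) = 0 := by simpa [Slot.pt] using h'
    have h1 := cutCoord_coe h.1.le h.2
    rw [h2, cutCoord_eq_zero_iff.mpr rfl] at h1
    exact h.1.ne h1
  | arc =>
    have h2 := h.1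
    have h3 := h.2
    show ‖μ + (t : UnitAddCircle) - μ‖ < ε
    rw [add_sub_cancel_left, (AddCircle.norm_coe_eq_abs_iff 1 one_ne_zero).mpr]
    · exact abs_lt.mpr h
    · rw [abs_one]
      exact abs_le.mpr ⟨by linarith, by linarith⟩
  | ray r =>
    refine ⟨h.1, ?_⟩
    simp only [Slot.pt]
    rw [depth_rayPt h.2.1.le h.2.2]
    exact h.2.1

theorem Slot.coord_shrink (s : Slot R) (τ : unitInterval) (x : RayedCircle v) :
    s.coord μ (s.shrink τ x) = s.coord μ x := by
  cases s <;> rfl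

theorem Slot.shrink_one (s : Slot R) (x : RayedCircle v) : s.shrink 1 x = x := by
  cases s
  · exact scale_one x
  · exact scale_one x
  · rfl

theorem Slot.shrink_zero {s : Slot R} {x : RayedCircle v} (h : s.Mem ε μ x) :
    s.shrink 0 x = s.pt μ (s.coord μ x) := by
  cases s with
  | cut => simp [Slot.shrink, Slot.pt, Slot.coord, scale_zero]
  | arc => simp [Slot.shrink, Slot.pt, Slot.coord, scale_zero]
  | ray r => exact (rayPt_depth h.2.ne').symm

theorem Slot.mem_shrink {s : Slot R} {x : RayedCircle v} (τ : unitInterval) (h : s.Mem ε μ x) :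
    s.Mem ε μ (s.shrink τ x) := by
  cases s <;> exact h

theorem Slot.continuous_pt (s : Slot R) : Continuous (s.pt μ : ℝ → RayedCircle v) := by
  cases s with
  | cut => exact continuous_circlePt.comp (continuous_const.add (AddCircle.continuous_mk' 1))
  | arc => exact continuous_circlePt.comp (continuous_const.add (AddCircle.continuous_mk' 1))
  | ray r => exact continuous_rayPt r

theorem Slot.continuous_shrink (s : Slot R) :
    Continuous fun p : unitInterval × RayedCircle v => s.shrink p.1 p.2 := by
  cases s
  · exact continuous_scale
  · exact continuous_scale
  · exact continuous_snd

theorem Slot.continuousAt_coord (hε : ε ≤ 1 / 4) {s : Slot R} {x : RayedCircle v}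
    (h : s.Mem ε μ x) : ContinuousAt (s.coord μ : RayedCircle v → ℝ) x := by
  cases s with
  | cut =>
    have h1 : ContinuousAt (fun x : RayedCircle v => x.angle - μ) x := by fun_prop
    exact ContinuousAt.comp (f := fun x : RayedCircle v => x.angle - μ)
      (continuousAt_cutCoord (sub_ne_zero.mpr h)) h1
  | arc =>
    have h' : ‖x.angle - μ‖ < ε := h
    have h1 : ContinuousAt (fun x : RayedCircle v => x.angle - μ) x := by fun_prop
    exact ContinuousAt.comp (f := fun x : RayedCircle v => x.angle - μ)
      (continuousAt_arcCoord (by linarith)) h1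
  | ray r => exact (continuous_depth r).continuousAt

theorem Slot.eventually_mem {s : Slot R} {x : RayedCircle v} (h : s.Mem ε μ x) :
    ∀ᶠ y in 𝓝 x, s.Mem ε μ y := by
  cases s with
  | cut => exact (continuous_angle.continuousAt).eventually_ne h
  | arc =>
    have : Continuous fun y : RayedCircle v => ‖y.angle - μ‖ := by fun_prop
    exact this.continuousAt.eventually_lt continuousAt_const h
  | ray r =>
    have := (continuous_depth (v := v) r).continuousAt.eventually_const_lt h.2
    exact this.mono fun y hy => ⟨h.1, hy⟩

variable [LinearOrder R]

/-- The coordinates of the configurations of a pattern. -/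
def PatternCoord (v : R → UnitAddCircle) (ε : ℝ) (μ : UnitAddCircle) (s : Fin 3 → Slot R)
    (C : Set (Fin 3 → ℝ)) : Set (Fin 3 → ℝ) :=
  {t | ((∀ i, (s i).Range v ε μ (t i)) ∧ ∀ i j, i < j → (s i).CoordRel (s j) (t i) (t j)) ∧ t ∈ C}

variable {s : Fin 3 → Slot R} {C : Set (Fin 3 → ℝ)}

/-- All conditions are linear inequalities; in the lexicographic comparison of rays, the choice of
ray does not depend on the coordinates. -/
theorem convex_patternCoord (hC : Convex ℝ C) : Convex ℝ (PatternCoord v ε μ s C) := by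
  rintro t ⟨⟨h1, h2⟩, h3⟩ t' ⟨⟨h1', h2'⟩, h3'⟩ a b ha hb hab
  have lt_comb : ∀ {p q p' q' : ℝ}, p < q → p' < q' → a * p + b * p' < a * q + b * q' := by
    intro p q p' q' h h'
    rcases ha.eq_or_lt with rfl | ha
    · have : b = 1 := by linarith
      subst this; linarith
    · nlinarith [mul_lt_mul_of_pos_left h ha, mul_le_mul_of_nonneg_left h'.le hb]
  have hb' : b = 1 - a := by linarith
  refine ⟨⟨fun i => ?_, fun i j hij => ?_⟩, hC h3 h3' ha hb hab⟩
  · have k := h1 i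
    have k' := h1' i
    simp only [Pi.add_apply, Pi.smul_apply, smul_eq_mul]
    cases hs : s i with
    | cut =>
      rw [hs] at k k'
      have e1 := lt_comb k.1 k'.1
      have e2 := lt_comb k.2 k'.2
      constructor <;> nlinarith
    | arc =>
      rw [hs] at k k'
      have e1 := lt_comb k.1 k'.1
      have e2 := lt_comb k.2 k'.2
      constructor <;> nlinarith
    | ray r =>
      rw [hs] at k k'
      have e1 := lt_comb k.2.1 k'.2.1
      have e2 := mul_le_mul_of_nonneg_left k.2.2 ha
      have e3 := mul_le_mul_of_nonneg_left k'.2.2 hb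
      refine ⟨k.1, ?_, ?_⟩ <;> nlinarith
  · have k := h2 i j hij
    have k' := h2' i j hij
    simp only [Pi.add_apply, Pi.smul_apply, smul_eq_mul]
    cases hs : s i <;> cases hs' : s j <;> rw [hs, hs'] at k k' <;>
      simp only [Slot.CoordRel] at k k' ⊢
    · exact lt_comb k k'
    · have e1 := lt_comb k.1.1 k'.1.1
      have e2 := lt_comb k.1.2 k'.1.2
      have e3 := lt_comb k.2.1 k'.2.1
      have e4 := lt_comb k.2.2 k'.2.2
      refine ⟨⟨?_, ?_⟩, ?_, ?_⟩ <;> nlinarith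
    · have e1 := lt_comb k.1 k'.1
      have e2 := lt_comb k.2 k'.2
      refine ⟨?_, ?_⟩ <;> nlinarith
    · rcases k with k | ⟨e, k⟩
      · exact Or.inl k
      · rcases k' with k' | ⟨-, k'⟩
        · exact Or.inl k'
        · exact Or.inr ⟨e, lt_comb k k'⟩

variable [Fintype R]

/-- The radius of an `arc` particle bounds the absolute value of its coordinate. The radius of the
other particle is exactly its distance from the centre, respectively its depth. -/
theorem Slot.coordRel_coord {s s' : Slot R} {x y : RayedCircle v}
    (hy : s'.Mem ε μ y) (h : s.Rel μ s' x y) : s.CoordRel s' (s.coord μ x) (s'.coord μ y) := by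
  cases s <;> cases s' <;> try exact h
  · have h1 : radius μ x < radius μ y := h
    rw [radius_of_angle_ne hy, norm_eq_min_cutCoord] at h1
    have h2 := (norm_le_radius μ x).trans_lt h1
    rw [norm_eq_abs_arcCoord, lt_min_iff, abs_lt, abs_lt] at h2
    simp only [Slot.CoordRel, Slot.coord]
    constructor <;> constructor <;> linarith
  · rename_i r
    have h1 : radius μ x < radius μ y := h
    obtain ⟨rfl, hy⟩ := hy
    rw [radius_of_depth hy.ne'] at h1
    have h2 := (norm_le_radius _ x).trans_lt h1
    rw [norm_eq_abs_arcCoord, abs_lt] at h2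
    simp only [Slot.CoordRel, Slot.coord]
    constructor <;> linarith

/-- Standard points of `arc` lie on the circle itself, where the radius equals the absolute value of
the coordinate, so the linear inequalities give back the comparison of radii. -/
theorem Slot.rel_pt (hε : ε ≤ 1 / 4) {s s' : Slot R} {t t' : ℝ} (ht : s.Range v ε μ t)
    (ht' : s'.Range v ε μ t') (h : s.CoordRel s' t t') :
    s.Rel μ s' (s.pt μ t : RayedCircle v) (s'.pt μ t') := by
  cases s <;> cases s' <;> try exact h
  · simp only [Slot.Rel, Slot.pt, angle_circlePt, add_sub_cancel_left]
    rw [cutCoord_coe ht.1.le ht.2, cutCoord_coe ht'.1.le ht'.2]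
    exact h
  · have h2 := ht.1
    have h3 := ht.2
    simp only [Slot.Rel, Slot.pt, radius_circlePt, add_sub_cancel_left]
    rw [(AddCircle.norm_coe_eq_abs_iff 1 one_ne_zero).mpr, norm_eq_min_cutCoord,
      cutCoord_coe ht'.1.le ht'.2, lt_min_iff, abs_lt, abs_lt]
    · simp only [Slot.CoordRel] at h
      constructor <;> constructor <;> linarith
    · rw [abs_one]
      exact abs_le.mpr ⟨by linarith, by linarith⟩
  · rename_i r
    have h2 := ht.1
    have h3 := ht.2
    obtain ⟨rfl, ht'⟩ := ht'
    have hd := depth_rayPt (v := v) (r := r) ht'.1.le ht'.2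
    simp only [Slot.Rel, Slot.pt, radius_circlePt, add_sub_cancel_left]
    rw [(AddCircle.norm_coe_eq_abs_iff 1 one_ne_zero).mpr,
      radius_of_depth (by rw [hd]; exact ht'.1.ne'), hd, abs_lt]
    · simp only [Slot.CoordRel] at h
      constructor <;> linarith
    · rw [abs_one]
      exact abs_le.mpr ⟨by linarith, by linarith⟩
  · simp only [Slot.Rel, Slot.pt]
    rw [depth_rayPt ht.2.1.le ht.2.2, depth_rayPt ht'.2.1.le ht'.2.2]
    exact h

/-- Shrinking cannot increase the smaller radius and leaves the larger one unchanged, since that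
particle is off the centre or on a ray that is kept fixed. -/
theorem Slot.rel_shrink {s s' : Slot R} {x y : RayedCircle v} (τ : unitInterval)
    (hy : s'.Mem ε μ y) (h : s.Rel μ s' x y) : s.Rel μ s' (s.shrink τ x) (s'.shrink τ y) := by
  cases s <;> cases s' <;> try exact h
  · simp only [Slot.Rel, Slot.shrink]
    rw [radius_scale_of_angle_ne τ hy]
    exact (radius_scale_le μ τ x).trans_lt h
  · exact (radius_scale_le μ τ x).trans_lt h

theorem Slot.rel_asymm {s s' : Slot R} {x y : RayedCircle v} (h : s.Rel μ s' x y) :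
    ¬ s'.Rel μ s y x := by
  cases s <;> cases s' <;> simp only [Slot.Rel, not_false_eq_true, not_lt] at h ⊢
  · exact h.le
  · rintro (h' | ⟨rfl, h'⟩)
    · rcases h with h | ⟨rfl, h⟩
      · exact lt_asymm h h'
      · exact lt_irrefl _ h'
    · rcases h with h | ⟨-, h⟩
      · exact lt_irrefl _ h
      · exact lt_asymm h h'

theorem Slot.ne_of_rel {s s' : Slot R} {x y : RayedCircle v} (hx : s.Mem ε μ x)
    (hy : s'.Mem ε μ y) (h : s.Rel μ s' x y) : x ≠ y := by
  rintro rfl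
  cases s <;> cases s' <;> simp only [Slot.Rel, lt_self_iff_false] at h
  · obtain ⟨rfl, hy⟩ := hy
    exact hx (angle_eq_of_depth hy.ne')
  · rcases h with h | ⟨rfl, h⟩
    · exact h.ne (eq_of_depth hy.2.ne' hx.2.ne')
    · exact lt_irrefl _ h

theorem Slot.eventually_rel (hε : ε ≤ 1 / 4) {s s' : Slot R} {Y : Type*} [TopologicalSpace Y]
    {f g : Y → RayedCircle v} (hf : Continuous f) (hg : Continuous g) {z : Y}
    (hx : s.Mem ε μ (f z)) (hy : s'.Mem ε μ (g z)) (h : s.Rel μ s' (f z) (g z)) :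
    ∀ᶠ w in 𝓝 z, s.Rel μ s' (f w) (g w) := by
  have c1 : ContinuousAt (fun w => s.coord μ (f w)) z :=
    ContinuousAt.comp (f := f) (Slot.continuousAt_coord hε hx) hf.continuousAt
  have c2 : ContinuousAt (fun w => s'.coord μ (g w)) z :=
    ContinuousAt.comp (f := g) (Slot.continuousAt_coord hε hy) hg.continuousAt
  have r1 : Continuous fun w => radius μ (f w) := (continuous_radius μ).comp hf
  have r2 : Continuous fun w => radius μ (g w) := (continuous_radius μ).comp hg
  cases s <;> cases s' <;> simp only [Slot.Rel] at h ⊢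
  · exact c1.eventually_lt c2 h
  · exact Filter.Eventually.of_forall fun _ => trivial
  · exact r1.continuousAt.eventually_lt r2.continuousAt h
  · exact r1.continuousAt.eventually_lt r2.continuousAt h
  · rcases h with h | ⟨h, h'⟩
    · exact Filter.Eventually.of_forall fun _ => Or.inl h
    · exact (c1.eventually_lt c2 h').mono fun _ hw => Or.inr ⟨h, hw⟩

/-- The ordered configurations whose particles are at places of the given kinds, in the
prescribed relative positions, with coordinates in a given set. -/
def Pattern (v : R → UnitAddCircle) (ε : ℝ) (μ : UnitAddCircle) (s : Fin 3 → Slot R)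
    (C : Set (Fin 3 → ℝ)) : Set (Fin 3 → RayedCircle v) :=
  {x | ((∀ i, (s i).Mem ε μ (x i)) ∧ ∀ i j, i < j → (s i).Rel μ (s j) (x i) (x j)) ∧
    (fun i => (s i).coord μ (x i)) ∈ C}

theorem Pattern.injective {x : Fin 3 → RayedCircle v} (hx : x ∈ Pattern v ε μ s C) :
    Function.Injective x := by
  intro i j hij
  by_contra hne
  rcases lt_or_gt_of_ne hne with h | h
  · exact Slot.ne_of_rel (hx.1.1 i) (hx.1.1 j) (hx.1.2 i j h) hij
  · exact Slot.ne_of_rel (hx.1.1 j) (hx.1.1 i) (hx.1.2 j i h) hij.symm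

theorem Pattern.continuousAt_coord (hε : ε ≤ 1 / 4) {x : Fin 3 → RayedCircle v}
    (hx : x ∈ Pattern v ε μ s C) :
    ContinuousAt (fun (x : Fin 3 → RayedCircle v) (i : Fin 3) => (s i).coord μ (x i)) x :=
  continuousAt_pi.mpr fun i => ContinuousAt.comp (f := fun x : Fin 3 → RayedCircle v => x i)
    (Slot.continuousAt_coord hε (hx.1.1 i)) (continuous_apply i).continuousAt

theorem Pattern.isOpen (hε : ε ≤ 1 / 4) (hC : IsOpen C) : IsOpen (Pattern v ε μ s C) := by
  rw [isOpen_iff_mem_nhds]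
  intro x hx
  have h1 : ∀ᶠ y in 𝓝 x, ∀ i, (s i).Mem ε μ (y i) :=
    Filter.eventually_all.mpr fun i =>
      (continuous_apply i).continuousAt.eventually (Slot.eventually_mem (hx.1.1 i))
  have h2 : ∀ᶠ y in 𝓝 x, ∀ i j, i < j → (s i).Rel μ (s j) (y i) (y j) :=
    Filter.eventually_all.mpr fun i => Filter.eventually_all.mpr fun j =>
      Filter.eventually_imp_distrib_left.mpr fun hij =>
        Slot.eventually_rel hε (continuous_apply i) (continuous_apply j) (hx.1.1 i) (hx.1.1 j)
          (hx.1.2 i j hij)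
  have h3 := (Pattern.continuousAt_coord hε hx).eventually (hC.mem_nhds hx.2)
  filter_upwards [h1, h2, h3] with y h1 h2 h3 using ⟨⟨h1, h2⟩, h3⟩

/-- A nonempty pattern is contractible: shrink the particles off the rays to the circle, then use
the convexity of the set of coordinates. -/
theorem Pattern.contractibleSpace (hε : ε ≤ 1 / 4) (hC : Convex ℝ C)
    (hne : (Pattern v ε μ s C).Nonempty) : ContractibleSpace (Pattern v ε μ s C) := by
  let κ : C(Pattern v ε μ s C, PatternCoord v ε μ s C) :=
    ⟨fun x => ⟨fun i => (s i).coord μ (x.1 i), ⟨⟨fun i => Slot.range_coord (x.2.1.1 i),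
      fun i j hij => Slot.coordRel_coord (x.2.1.1 j) (x.2.1.2 i j hij)⟩, x.2.2⟩⟩, by
      refine Continuous.subtype_mk (continuous_iff_continuousAt.mpr fun x => ?_) _
      exact ContinuousAt.comp (f := fun x : Pattern v ε μ s C => x.1)
        (Pattern.continuousAt_coord hε x.2) continuousAt_subtype_val⟩
  -- Standard points realise every admissible coordinate vector; shrinking is a homotopy from `e ∘
  -- κ` to the identity, and the identity therefore factors up to homotopy through a convex set.
  let e : C(PatternCoord v ε μ s C, Pattern v ε μ s C) :=
    ⟨fun t => ⟨fun i => (s i).pt μ (t.1 i), ⟨⟨fun i => Slot.mem_pt hε (t.2.1.1 i),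
      fun i j hij => Slot.rel_pt hε (t.2.1.1 i) (t.2.1.1 j) (t.2.1.2 i j hij)⟩, by
        have : (fun i => (s i).coord μ ((s i).pt μ (t.1 i) : RayedCircle v)) = t.1 := by
          funext i
          have k := t.2.1.1 i
          cases hs : s i with
          | cut =>
            rw [hs] at k
            simp only [Slot.coord, Slot.pt, angle_circlePt, add_sub_cancel_left]
            exact cutCoord_coe k.1.le k.2
          | arc =>
            rw [hs] at k
            have k1 := k.1
            have k2 := k.2
            simp only [Slot.coord, Slot.pt, angle_circlePt, add_sub_cancel_left]
            exact arcCoord_coe (by linarith) (by linarith)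
          | ray r =>
            rw [hs] at k
            exact depth_rayPt k.2.1.le k.2.2
        rw [this]
        exact t.2.2⟩⟩, by
      refine Continuous.subtype_mk (continuous_pi fun i => ?_) _
      exact (Slot.continuous_pt (s i)).comp ((continuous_apply i).comp continuous_subtype_val)⟩
  have hhom : (e.comp κ).Homotopic (ContinuousMap.id _) := by
    refine ⟨⟨⟨fun p => ⟨fun i => (s i).shrink p.1 (p.2.1 i),
      ⟨⟨fun i => Slot.mem_shrink p.1 (p.2.2.1.1 i),
        fun i j hij => Slot.rel_shrink p.1 (p.2.2.1.1 j) (p.2.2.1.2 i j hij)⟩, by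
          simp only [Slot.coord_shrink]
          exact p.2.2.2⟩⟩, ?_⟩, ?_, ?_⟩⟩
    · refine Continuous.subtype_mk (continuous_pi fun i => ?_) _
      exact (Slot.continuous_shrink (s i)).comp (continuous_fst.prodMk
        ((continuous_apply i).comp (continuous_subtype_val.comp continuous_snd)))
    · intro x
      exact Subtype.ext (funext fun i => Slot.shrink_zero (x.2.1.1 i))
    · intro x
      exact Subtype.ext (funext fun i => Slot.shrink_one _ _)
  have hneK : (PatternCoord v ε μ s C).Nonempty := ⟨_, (κ ⟨_, hne.some_mem⟩).2⟩
  have hK : ContractibleSpace (PatternCoord v ε μ s C) :=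
    (convex_patternCoord hC).contractibleSpace hneK
  rw [contractible_iff_id_nullhomotopic]
  obtain ⟨c, hc⟩ := ((id_nullhomotopic (PatternCoord v ε μ s C)).comp_right e).comp_left κ
  exact ⟨c, hhom.symm.trans hc⟩

end RayedCircle

/-! ### Sets with null-homotopic loops -/

/-- Loops in an embedded simply connected space are null-homotopic. -/
theorem Topology.IsEmbedding.loopsNull_range {Y X : Type*} [TopologicalSpace Y]
    [TopologicalSpace X] [SimplyConnectedSpace Y] {f : Y → X} (hf : IsEmbedding f) :
    LoopsNull (range f) := by
  intro p γ hγ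
  obtain ⟨y, rfl⟩ : ∃ y, f y = p := γ.source ▸ hγ 0
  let g : C(unitInterval, Y) := ⟨fun t => hf.toHomeomorph.symm ⟨γ t, hγ t⟩,
    hf.toHomeomorph.symm.continuous.comp (Continuous.subtype_mk γ.continuous _)⟩
  have hg : ∀ t, f (g t) = γ t := fun t =>
    congrArg Subtype.val (hf.toHomeomorph.apply_symm_apply ⟨γ t, hγ t⟩)
  let γ' : Path y y := ⟨g, hf.injective (by rw [ContinuousMap.toFun_eq_coe, hg, γ.source]),
    hf.injective (by rw [ContinuousMap.toFun_eq_coe, hg, γ.target])⟩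
  have e : γ'.map hf.continuous = γ := Path.ext (funext hg)
  have h := (SimplyConnectedSpace.paths_homotopic γ' (Path.refl _)).map ⟨f, hf.continuous⟩
  change (γ'.map hf.continuous).Homotopic ((Path.refl _).map hf.continuous) at h
  rw [e] at h
  exact h

theorem loopsNull_empty {X : Type*} [TopologicalSpace X] : LoopsNull (∅ : Set X) :=
  fun _ _ h => (h 0).elim

/-- Distinct members are open and disjoint, so the times that a loop spends in one member form a
clopen set. -/
theorem LoopsNull.iUnion {ι X : Type*} [TopologicalSpace X] {P : ι → Set X}
    (ho : ∀ i, IsOpen (P i)) (hd : ∀ i j x, x ∈ P i → x ∈ P j → P i = P j)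
    (h : ∀ i, LoopsNull (P i)) : LoopsNull (⋃ i, P i) := by
  intro p γ hγ
  obtain ⟨i, hi⟩ := mem_iUnion.mp (hγ 0)
  have hc : IsClopen {t | γ t ∈ P i} := by
    refine ⟨isOpen_compl_iff.mp (isOpen_iff_mem_nhds.mpr fun t ht => ?_),
      (ho i).preimage γ.continuous⟩
    obtain ⟨j, hj⟩ := mem_iUnion.mp (hγ t)
    filter_upwards [γ.continuous.continuousAt.eventually ((ho j).mem_nhds hj)] with u hu hu'
    exact ht (by rw [mem_ofPred_eq, hd i j _ hu' hu]; exact hj)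
  have hu := hc.eq_univ ⟨0, hi⟩
  exact h i p γ fun t => (hu ▸ mem_univ t : t ∈ {t | γ t ∈ P i})

/-! ### Unordered configurations -/

section Conf

variable {k : ℕ} {X : Type}

/-- The unordered configuration underlying an ordered one. -/
def Conf.mk (p : OrderedConf k X) : Conf k X := Quotient.mk (confSetoid k X) p

theorem Conf.mk_eq_mk {p q : OrderedConf k X} :
    Conf.mk p = Conf.mk q ↔ ∃ σ : Equiv.Perm (Fin k), p.1 ∘ σ = q.1 := Quotient.eq

/-- The unordered configurations underlying the ordered configurations in a given set. -/
def confImage (O : Set (Fin k → X)) : Set (Conf k X) := Conf.mk '' (Subtype.val ⁻¹' O)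

theorem mk_mem_confImage {p : OrderedConf k X} {O : Set (Fin k → X)} :
    Conf.mk p ∈ confImage O ↔ ∃ σ : Equiv.Perm (Fin k), p.1 ∘ σ ∈ O := by
  constructor
  · rintro ⟨q, hq, h⟩
    obtain ⟨σ, hσ⟩ := Conf.mk_eq_mk.mp h.symm
    exact ⟨σ, hσ ▸ hq⟩
  · rintro ⟨σ, hσ⟩
    exact ⟨⟨p.1 ∘ σ, p.2.comp σ.injective⟩, hσ, (Conf.mk_eq_mk.mpr ⟨σ, rfl⟩).symm⟩

theorem confImage_iUnion {ι : Type*} (O : ι → Set (Fin k → X)) :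
    confImage (⋃ i, O i) = ⋃ i, confImage (O i) := by
  rw [confImage, preimage_iUnion, image_iUnion]
  rfl

variable [TopologicalSpace X]

theorem Conf.continuous_mk : Continuous (Conf.mk : OrderedConf k X → Conf k X) :=
  continuous_quotient_mk'

theorem Conf.isOpenMap_mk : IsOpenMap (Conf.mk : OrderedConf k X → Conf k X) := by
  intro W hW
  have : Conf.mk ⁻¹' (Conf.mk '' W) = ⋃ σ : Equiv.Perm (Fin k),
      (fun p : OrderedConf k X => (⟨p.1 ∘ σ, p.2.comp σ.injective⟩ : OrderedConf k X)) ⁻¹' W := by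
    ext p
    simp only [mem_preimage, mem_image, mem_iUnion]
    constructor
    · rintro ⟨q, hq, h⟩
      obtain ⟨σ, hσ⟩ := Conf.mk_eq_mk.mp h.symm
      exact ⟨σ, (Subtype.ext hσ : (⟨p.1 ∘ σ, _⟩ : OrderedConf k X) = q) ▸ hq⟩
    · rintro ⟨σ, hσ⟩
      exact ⟨_, hσ, (Conf.mk_eq_mk.mpr ⟨σ, rfl⟩).symm⟩
  have hq : IsQuotientMap (Conf.mk : OrderedConf k X → Conf k X) := isQuotientMap_quotient_mk'
  rw [← hq.isOpen_preimage, this]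
  refine isOpen_iUnion fun σ => hW.preimage (Continuous.subtype_mk (continuous_pi fun i => ?_) _)
  exact (continuous_apply (σ i)).comp continuous_subtype_val

theorem isOpen_confImage {O : Set (Fin k → X)} (hO : IsOpen O) : IsOpen (confImage O) :=
  Conf.isOpenMap_mk _ (hO.preimage continuous_subtype_val)

theorem isPreconnected_confImage {O : Set (Fin k → X)} (hi : ∀ x ∈ O, Function.Injective x)
    (h : IsPreconnected O) : IsPreconnected (confImage O) := by
  have : confImage O = range fun x : O => Conf.mk ⟨x.1, hi x.1 x.2⟩ := by
    ext c
    constructor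
    · rintro ⟨p, hp, rfl⟩
      exact ⟨⟨p.1, hp⟩, rfl⟩
    · rintro ⟨x, rfl⟩
      exact ⟨_, x.2, rfl⟩
  have := isPreconnected_iff_preconnectedSpace.mp h
  rw [‹confImage O = _›]
  exact isPreconnected_range (Conf.continuous_mk.comp
    (Continuous.subtype_mk continuous_subtype_val _))

/-- A simply connected open set of ordered configurations on which the symmetric group acts freely
in the strong sense that no point can be moved within the set has an image with null-homotopic
loops. -/
theorem loopsNull_confImage {O : Set (Fin k → X)} (hO : IsOpen O)
    (hi : ∀ x ∈ O, Function.Injective x) [SimplyConnectedSpace O]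
    (hσ : ∀ x ∈ O, ∀ σ : Equiv.Perm (Fin k), x ∘ σ ∈ O → σ = 1) : LoopsNull (confImage O) := by
  let ι : O → OrderedConf k X := fun x => ⟨x.1, hi x.1 x.2⟩
  have hι : IsOpenEmbedding ι := by
    refine .of_continuous_injective_isOpenMap (Continuous.subtype_mk continuous_subtype_val _)
      (fun x y h => Subtype.ext (congrArg (fun p : OrderedConf k X => p.1) h)) fun W hW => ?_
    have : ι '' W = Subtype.val ⁻¹' (Subtype.val '' W) := by
      ext p
      constructor
      · rintro ⟨x, hx, rfl⟩
        exact ⟨x, hx, rfl⟩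
      · rintro ⟨x, hx, h⟩
        exact ⟨x, hx, Subtype.ext h⟩
    rw [this]
    exact (hO.isOpenMap_subtype_val W hW).preimage continuous_subtype_val
  have hf : IsOpenEmbedding (Conf.mk ∘ ι) := by
    refine .of_continuous_injective_isOpenMap (Conf.continuous_mk.comp hι.continuous)
      (fun x y h => ?_) (Conf.isOpenMap_mk.comp hι.isOpenMap)
    obtain ⟨σ, h⟩ := Conf.mk_eq_mk.mp h
    have h1 := hσ x.1 x.2 σ (h ▸ y.2)
    subst h1
    exact Subtype.ext h
  have : confImage O = range (Conf.mk ∘ ι) := by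
    ext c
    constructor
    · rintro ⟨p, hp, rfl⟩
      exact ⟨⟨p.1, hp⟩, rfl⟩
    · rintro ⟨x, rfl⟩
      exact ⟨_, x.2, rfl⟩
  rw [this]
  exact hf.isEmbedding.loopsNull_range

theorem isOpen_setOf_injective [T2Space X] : IsOpen {x : Fin k → X | Function.Injective x} := by
  have : {x : Fin k → X | Function.Injective x} =
      ⋂ i, ⋂ j, ⋂ _ : i ≠ j, {x | x i ≠ x j} := by
    ext x
    simp only [mem_ofPred_eq, mem_iInter]
    exact ⟨fun h i j hij e => hij (h e), fun h i j e => by_contra fun hij => h i j hij e⟩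
  rw [this]
  exact isOpen_iInter_of_finite fun i => isOpen_iInter_of_finite fun j =>
    isOpen_iInter_of_finite fun _ => isOpen_ne_fun (continuous_apply i) (continuous_apply j)

instance [T2Space X] [LocallyPathConnectedSpace X] : LocallyPathConnectedSpace (Conf k X) :=
  haveI : LocallyPathConnectedSpace (OrderedConf k X) :=
    (isOpen_setOf_injective (k := k) (X := X)).locallyPathConnectedSpace
  inferInstanceAs (LocallyPathConnectedSpace (Quotient (confSetoid k X)))

end Conf

/-! ### Rigidity: the three families of patterns -/

namespace RayedCircle

variable {R : Type} {v : R → UnitAddCircle} {ε : ℝ} {m μ : UnitAddCircle}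

/-- Apart from `arc`, the kinds of places exclude one another: off the centre, or on one particular
ray. -/
theorem Slot.eq_of_mem {s s' : Slot R} {x : RayedCircle v} (hs : s ≠ .arc) (hs' : s' ≠ .arc)
    (h : s.Mem ε μ x) (h' : s'.Mem ε μ x) : s = s' := by
  cases s <;> cases s' <;> simp only [ne_eq, not_true_eq_false] at hs hs' ⊢
  · exact (h ((angle_eq_of_depth h'.2.ne').trans h'.1)).elim
  · exact (h' ((angle_eq_of_depth h.2.ne').trans h.1)).elim
  · rw [eq_of_depth h'.2.ne' h.2.ne']

theorem Slot.angle_eq_of_mem_ray {r : R} {x : RayedCircle v} (h : (Slot.ray r).Mem ε μ x) :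
    x.angle = μ :=
  (angle_eq_of_depth h.2.ne').trans h.1

/-- The places of rays are away from `m` and from each other at the scale `ε`. -/
structure IsSeparated (v : R → UnitAddCircle) (m : UnitAddCircle) (ε : ℝ) : Prop where
  pos : 0 < ε
  le : ε ≤ 1 / 4
  base : ∀ r, 2 * ε ≤ ‖v r - m‖
  sep : ∀ r s, v r ≠ v s → 2 * ε ≤ ‖v r - v s‖

theorem IsSeparated.ne (h : IsSeparated v m ε) (r : R) : v r ≠ m := by
  intro e
  have h1 := h.base r
  have h2 := h.pos
  rw [e, sub_self, norm_zero] at h1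
  linarith

variable [Fintype R] [LinearOrder R]

theorem Slot.radius_lt_of_rel_arc {s : Slot R} {x y : RayedCircle v} (h : Slot.arc.Rel μ s x y) :
    radius μ x < radius μ y := by
  cases s
  exacts [h, h.elim, h]

variable {s s' : Fin 3 → Slot R} {C C' : Set (Fin 3 → ℝ)} {x : Fin 3 → RayedCircle v}
  {σ : Equiv.Perm (Fin 3)}

theorem perm_eq_one_of_lt :
    ∀ σ : Equiv.Perm (Fin 3), (∀ i j, i < j → σ i < σ j) → σ = 1 := by
  decide

/-- A configuration has at most one ordering that fits patterns about a given centre. -/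
theorem Pattern.rigid (hs : ∀ i, i ≠ 0 → s i ≠ .arc) (hs' : ∀ i, i ≠ 0 → s' i ≠ .arc)
    (h0 : s 0 = .arc ↔ s' 0 = .arc) (hx : x ∈ Pattern v ε μ s C)
    (hx' : x ∘ σ ∈ Pattern v ε μ s' C') : σ = 1 ∧ s = s' := by
  -- The `arc` particle has strictly the smallest radius, so two orderings cannot disagree about it.
  have hσ : s 0 = .arc → σ 0 = 0 := by
    intro h
    by_contra hne
    have h1 := hx.1.2 0 (σ 0) (Fin.pos_of_ne_zero hne)
    have h2 := hx'.1.2 0 (σ.symm 0) (Fin.pos_of_ne_zero fun e => hne (by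
      rw [← e, Equiv.apply_symm_apply]; exact e.symm))
    rw [h] at h1
    rw [h0.mp h] at h2
    have h3 := Slot.radius_lt_of_rel_arc h1
    have h4 := Slot.radius_lt_of_rel_arc h2
    simp only [Function.comp_apply, Equiv.apply_symm_apply] at h4
    exact lt_asymm h3 h4
  have hss : ∀ i, s (σ i) = s' i := by
    intro i
    by_cases h : s 0 = .arc
    · by_cases hi : i = 0
      · rw [hi, hσ h, h, h0.mp h]
      · have : σ i ≠ 0 := fun e => hi (σ.injective (e.trans (hσ h).symm))
        exact Slot.eq_of_mem (hs _ this) (hs' _ hi) (hx.1.1 _) (hx'.1.1 i)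
    · have k : ∀ i, s i ≠ .arc := fun i => by
        by_cases hi : i = 0
        exacts [hi ▸ h, hs i hi]
      have k' : ∀ i, s' i ≠ .arc := fun i => by
        by_cases hi : i = 0
        exacts [hi ▸ fun e => h (h0.mpr e), hs' i hi]
      exact Slot.eq_of_mem (k _) (k' _) (hx.1.1 _) (hx'.1.1 i)
  have hσ1 : σ = 1 := by
    refine perm_eq_one_of_lt σ fun i j hij => ?_
    by_contra hle
    have hlt : σ j < σ i := lt_of_le_of_ne (not_lt.mp hle) (σ.injective.ne hij.ne')
    have h1 := hx.1.2 _ _ hlt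
    rw [hss, hss] at h1
    exact Slot.rel_asymm h1 (hx'.1.2 i j hij)
  subst hσ1
  exact ⟨rfl, funext hss⟩

theorem Pattern.angle_injective_of_cut (hs : ∀ i, s i = .cut) (hx : x ∈ Pattern v ε μ s C) :
    Function.Injective fun i => (x i).angle := by
  have key : ∀ i j, i < j → (x i).angle ≠ (x j).angle := fun i j hij e => by
    have h := hx.1.2 i j hij
    rw [hs, hs] at h
    simp [Slot.Rel, e] at h
  intro i j e
  by_contra hne
  rcases lt_or_gt_of_ne hne with h | h
  exacts [key i j h e, key j i h e.symm]

/-- The orderings of a configuration that fit one of a family of patterns. -/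
def PatternUnion (v : R → UnitAddCircle) (ε : ℝ) (A : Set (UnitAddCircle × (Fin 3 → Slot R))) :
    Set (Fin 3 → RayedCircle v) :=
  ⋃ κ : A, Pattern v ε κ.1.1 κ.1.2 univ

theorem mem_patternUnion {A : Set (UnitAddCircle × (Fin 3 → Slot R))} :
    x ∈ PatternUnion v ε A ↔ ∃ μ s, (μ, s) ∈ A ∧ x ∈ Pattern v ε μ s univ := by
  simp [PatternUnion]

theorem isOpen_patternUnion (hε : ε ≤ 1 / 4) (A : Set (UnitAddCircle × (Fin 3 → Slot R))) :
    IsOpen (PatternUnion v ε A) :=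
  isOpen_iUnion fun _ => Pattern.isOpen hε isOpen_univ

/-- A configuration has at most one ordering that fits one of the patterns of the family, and it
fits only one of them. -/
def IsRigid (v : R → UnitAddCircle) (ε : ℝ) (A : Set (UnitAddCircle × (Fin 3 → Slot R))) : Prop :=
  ∀ (x : Fin 3 → RayedCircle v) (σ : Equiv.Perm (Fin 3)), ∀ κ ∈ A, ∀ κ' ∈ A,
    x ∈ Pattern v ε κ.1 κ.2 univ → x ∘ σ ∈ Pattern v ε κ'.1 κ'.2 univ → σ = 1 ∧ κ = κ'

theorem IsRigid.loopsNull {A : Set (UnitAddCircle × (Fin 3 → Slot R))} (hA : IsRigid v ε A)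
    (hε : ε ≤ 1 / 4) : LoopsNull (confImage (PatternUnion v ε A)) := by
  rw [PatternUnion, confImage_iUnion]
  refine LoopsNull.iUnion (fun κ => isOpen_confImage (Pattern.isOpen hε isOpen_univ)) ?_ ?_
  · rintro κ κ' c ⟨p, hp, rfl⟩ hc
    obtain ⟨σ, hσ⟩ := mk_mem_confImage.mp hc
    rw [Subtype.ext (hA p.1 σ κ κ.2 κ' κ'.2 hp hσ).2]
  · intro κ
    rcases (Pattern v ε κ.1.1 κ.1.2 univ).eq_empty_or_nonempty with h | h
    · rw [h, confImage, preimage_empty, image_empty]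
      exact loopsNull_empty
    · have := Pattern.contractibleSpace hε convex_univ h
      exact loopsNull_confImage (Pattern.isOpen hε isOpen_univ) (fun x hx => Pattern.injective hx)
        fun x hx σ hσ => (hA x σ κ κ.2 κ κ.2 hx hσ).1

/-- The first family of patterns: three particles on the circle cut open at `m`, or at least two
particles on rays at a centre. -/
def cutPatterns (m : UnitAddCircle) : Set (UnitAddCircle × (Fin 3 → Slot R)) :=
  {κ | (κ.1 = m ∧ ∀ i, κ.2 i = .cut) ∨ ((∀ i, κ.2 i ≠ .arc) ∧
    ∃ i j, i ≠ j ∧ (∃ r, κ.2 i = .ray r) ∧ ∃ r, κ.2 j = .ray r)}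

/-- The second family of patterns: one particle on the circle near `m`. -/
def basePatterns (m : UnitAddCircle) : Set (UnitAddCircle × (Fin 3 → Slot R)) :=
  {(m, ![.arc, .cut, .cut])}

/-- The third family of patterns: one particle near a centre, and a particle on a ray there. -/
def starPatterns : Set (UnitAddCircle × (Fin 3 → Slot R)) :=
  {κ | κ.2 0 = .arc ∧ (κ.2 1 = .cut ∨ ∃ r, κ.2 1 = .ray r) ∧ ∃ r, κ.2 2 = .ray r}

theorem exists_eq_of_pairs :
    ∀ i j k l : Fin 3, i ≠ j → k ≠ l → i = k ∨ i = l ∨ j = k ∨ j = l := by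
  decide

theorem not_four_distinct :
    ∀ i j k : Fin 3, i ≠ 0 → j ≠ 0 → i ≠ j → k ≠ 0 → k ≠ i → k = j := by
  decide

/-- Two particles over a common point exclude the pattern cut at `m`, where the angles are distinct.
Two centres with two particles each share a particle, because any two pairs among three indices
meet. -/
theorem isRigid_cutPatterns (m : UnitAddCircle) : IsRigid v ε (cutPatterns m) := by
  have two : ∀ {x : Fin 3 → RayedCircle v} {μ s},
      (∃ i j, i ≠ j ∧ (∃ r, s i = .ray r) ∧ ∃ r, s j = .ray r) → x ∈ Pattern v ε μ s univ →
      ∃ i j, i ≠ j ∧ (x i).angle = μ ∧ (x j).angle = μ := by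
    rintro x μ s ⟨i, j, hij, ⟨r, hr⟩, ⟨r', hr'⟩⟩ hx
    have h1 := hx.1.1 i
    have h2 := hx.1.1 j
    rw [hr] at h1
    rw [hr'] at h2
    exact ⟨i, j, hij, Slot.angle_eq_of_mem_ray h1, Slot.angle_eq_of_mem_ray h2⟩
  have cut_ne : ∀ {s : Fin 3 → Slot R}, (∀ i, s i = .cut) → ∀ i, s i ≠ .arc := by
    intro s h i
    rw [h]
    nofun
  have same : ∀ {x : Fin 3 → RayedCircle v} {σ : Equiv.Perm (Fin 3)} {μ μ' s s'}, μ = μ' →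
      (∀ i, s i ≠ .arc) → (∀ i, s' i ≠ .arc) → x ∈ Pattern v ε μ s univ →
      x ∘ σ ∈ Pattern v ε μ' s' univ → σ = 1 ∧ (μ, s) = (μ', s') := by
    rintro x σ μ _ s s' rfl hs hs' hx hx'
    obtain ⟨h1, h2⟩ := Pattern.rigid (fun i _ => hs i) (fun i _ => hs' i)
      (iff_of_false (hs 0) (hs' 0)) hx hx'
    exact ⟨h1, by rw [h2]⟩
  rintro x σ ⟨μ, s⟩ hκ ⟨μ', s'⟩ hκ' hx hx'
  rcases hκ with ⟨h1, h2⟩ | ⟨h1, h2⟩ <;> rcases hκ' with ⟨h1', h2'⟩ | ⟨h1', h2'⟩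
  · exact same (h1.trans h1'.symm) (cut_ne h2) (cut_ne h2') hx hx'
  · obtain ⟨i, j, hij, hi, hj⟩ := two h2' hx'
    exact (hij (σ.injective (Pattern.angle_injective_of_cut h2 hx (hi.trans hj.symm)))).elim
  · obtain ⟨i, j, hij, hi, hj⟩ := two h2 hx
    have := Pattern.angle_injective_of_cut h2' hx'
    refine (hij (σ.symm.injective (this ?_))).elim
    simp only [Function.comp_apply, Equiv.apply_symm_apply]
    exact hi.trans hj.symm
  · obtain ⟨i, j, hij, hi, hj⟩ := two h2 hx
    obtain ⟨k, l, hkl, hk, hl⟩ := two h2' hx'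
    refine same ?_ h1 h1' hx hx'
    rcases exists_eq_of_pairs i j (σ k) (σ l) hij (σ.injective.ne hkl) with
      rfl | rfl | rfl | rfl
    exacts [hi.symm.trans hk, hi.symm.trans hl, hj.symm.trans hk, hj.symm.trans hl]

theorem isRigid_basePatterns (m : UnitAddCircle) : IsRigid v ε (basePatterns m) := by
  rintro x σ κ rfl κ' rfl hx hx'
  refine ⟨(Pattern.rigid ?_ ?_ Iff.rfl hx hx').1, rfl⟩ <;>
  · intro i hi
    fin_cases i
    · exact (hi rfl).elim
    all_goals nofun

/-- A pattern places two particles within `ε` of its centre. Distinct centres are at least `2 * ε`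
apart, so two of them would require four particles. -/
theorem isRigid_starPatterns (h : IsSeparated v m ε) : IsRigid v ε starPatterns := by
  have nonarc : ∀ {κ : UnitAddCircle × (Fin 3 → Slot R)}, κ ∈ starPatterns →
      ∀ i, i ≠ 0 → κ.2 i ≠ .arc := by
    rintro κ ⟨-, h1, ⟨r, h2⟩⟩ i hi
    fin_cases i
    · exact (hi rfl).elim
    · rcases h1 with h1 | ⟨r, h1⟩ <;> simp [h1]
    · simp [h2]
  rintro x σ ⟨μ, s⟩ hκ ⟨μ', s'⟩ hκ' hx hx'
  have hμ : μ = μ' := by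
    by_contra hne
    obtain ⟨h0, -, ⟨r, h2⟩⟩ := hκ
    obtain ⟨h0', -, ⟨r', h2'⟩⟩ := hκ'
    have a0 := hx.1.1 0
    have a2 := hx.1.1 2
    have b0 := hx'.1.1 0
    have b2 := hx'.1.1 2
    dsimp only [Function.comp_apply] at a0 a2 b0 b2 h0 h2 h0' h2'
    rw [h0] at a0
    rw [h2] at a2
    rw [h0'] at b0
    rw [h2'] at b2
    have a2' := Slot.angle_eq_of_mem_ray a2
    have b2' := Slot.angle_eq_of_mem_ray b2
    have hsep : 2 * ε ≤ ‖μ - μ'‖ := by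
      rw [← a2.1, ← b2.1]
      refine h.sep r r' ?_
      rw [a2.1, b2.1]
      exact hne
    have hpos := h.pos
    have e1 : σ 0 ≠ 0 := by
      intro e
      rw [e] at b0
      have a0 : ‖(x 0).angle - μ‖ < ε := a0
      have b0 : ‖(x 0).angle - μ'‖ < ε := b0
      have := norm_sub_le_norm_sub_add_norm_sub μ (x 0).angle μ'
      rw [norm_sub_rev μ (x 0).angle] at this
      linarith
    have e2 : σ 0 ≠ 2 := by
      intro e
      rw [e] at b0
      have b0 : ‖(x 2).angle - μ'‖ < ε := b0
      rw [a2'] at b0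
      linarith
    have e3 : σ 2 ≠ 0 := by
      intro e
      rw [e] at b2'
      have a0 : ‖(x 0).angle - μ‖ < ε := a0
      rw [b2', norm_sub_rev] at a0
      linarith
    have e4 : σ 2 ≠ 2 := by
      intro e
      rw [e] at b2'
      exact hne (a2'.symm.trans b2')
    exact absurd (σ.injective (not_four_distinct 2 (σ 0) (σ 2) (by decide) e1 e2.symm e3 e4))
      (by decide)
  subst hμ
  obtain ⟨h1, h2⟩ := Pattern.rigid (nonarc hκ) (nonarc hκ') (iff_of_true hκ.1 hκ'.1) hx hx'
  exact ⟨h1, congrArg (Prod.mk μ) h2⟩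

end RayedCircle

/-! ### The three families cover all configurations -/

namespace RayedCircle

variable {R : Type} {v : R → UnitAddCircle} {ε : ℝ} {m μ : UnitAddCircle}
  {x : Fin 3 → RayedCircle v}

theorem exists_perm_strictMono {α : Type*} [LinearOrder α] {f : Fin 3 → α}
    (hf : Function.Injective f) : ∃ σ : Equiv.Perm (Fin 3), StrictMono (f ∘ σ) :=
  ⟨Tuple.sort f,
    (Tuple.monotone_sort f).strictMono_of_injective (hf.comp (Tuple.sort f).injective)⟩

open Classical in
/-- The kind of place in which a particle is relative to a centre. -/
noncomputable def slotOf (μ : UnitAddCircle) (x : RayedCircle v) : Slot R :=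
  if x.angle ≠ μ then .cut else if h : ∃ r, 0 < x.depth r then .ray h.choose else .arc

/-- A key by which to order particles relative to a centre: first the centre, then the particles
off the centre, then the rays. -/
noncomputable def Slot.key (s : Slot R) (x : RayedCircle v) : WithBot (WithBot (R ×ₗ ℝ)) :=
  match s with
  | .arc => ⊥
  | .cut => ((⊥ : WithBot (R ×ₗ ℝ)) : WithBot (WithBot (R ×ₗ ℝ)))
  | .ray r => (((toLex (r, x.depth r) : R ×ₗ ℝ) : WithBot (R ×ₗ ℝ)) : WithBot (WithBot (R ×ₗ ℝ)))

theorem slotOf_eq_cut_iff {x : RayedCircle v} : slotOf μ x = .cut ↔ x.angle ≠ μ := by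
  unfold slotOf
  split_ifs <;> simp_all

theorem angle_of_slotOf_arc {x : RayedCircle v} (h : slotOf μ x = .arc) : x = circlePt μ := by
  unfold slotOf at h
  split_ifs at h with h1 h2
  rcases eq_circlePt_or_exists_depth x with h3 | h3
  · rw [h3, not_not.mp h1]
  · exact (h2 h3).elim

theorem mem_slotOf (hε : 0 < ε) (μ : UnitAddCircle) (x : RayedCircle v) :
    (slotOf μ x).Mem ε μ x := by
  unfold slotOf
  split_ifs with h1 h2
  · exact h1
  · exact ⟨(angle_eq_of_depth h2.choose_spec.ne').symm.trans (not_not.mp h1), h2.choose_spec⟩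
  · show ‖x.angle - μ‖ < ε
    rw [not_not.mp h1, sub_self, norm_zero]
    exact hε

theorem Slot.eq_of_key_eq {s s' : Slot R} {x y : RayedCircle v} (h : s.key x = s'.key y) :
    s = s' ∧ ∀ r, s = .ray r → x.depth r = y.depth r := by
  cases s <;> cases s' <;> simp [Slot.key] at h ⊢
  exact ⟨h.1, h.1 ▸ h.2⟩

theorem angle_injective_of_three (h1 : (x 0).angle ≠ (x 1).angle) (h2 : (x 0).angle ≠ (x 2).angle)
    (h3 : (x 1).angle ≠ (x 2).angle) : Function.Injective fun i => (x i).angle := by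
  intro i j hij
  fin_cases i <;> fin_cases j <;> simp_all [eq_comm]

/-- With two particles over the centre, at most one is off it, so the common key of the `cut`
particles is used once. A particle over the centre is determined by its ray and depth, or is the
centre itself. -/
theorem key_injective (hx : Function.Injective x) {i j : Fin 3} (hij : i ≠ j)
    (hi : (x i).angle = μ) (hj : (x j).angle = μ) :
    Function.Injective fun i => (slotOf μ (x i)).key (x i) := by
  intro k l h
  by_contra hkl
  obtain ⟨h1, h2⟩ := Slot.eq_of_key_eq h
  have m1 := mem_slotOf one_pos μ (x k)
  have m2 := mem_slotOf one_pos μ (x l)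
  cases hs : slotOf μ (x k) with
  | arc =>
    rw [hs] at h1
    exact hkl (hx ((angle_of_slotOf_arc hs).trans (angle_of_slotOf_arc h1.symm).symm))
  | cut =>
    rw [hs] at h1
    have c1 := slotOf_eq_cut_iff.mp hs
    have c2 := slotOf_eq_cut_iff.mp h1.symm
    rcases exists_eq_of_pairs i j k l hij hkl with rfl | rfl | rfl | rfl
    exacts [c1 hi, c2 hi, c1 hj, c2 hj]
  | ray r =>
    rw [← h1, hs] at m2
    rw [hs] at m1
    refine hkl (hx ?_)
    rw [← rayPt_depth m1.2.ne', ← rayPt_depth m2.2.ne', h2 r hs]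

variable [Fintype R]

theorem IsSeparated.radius_eq (h : IsSeparated v m ε) (x : RayedCircle v) :
    radius m x = ‖x.angle - m‖ := by
  rw [radius, add_eq_left]
  exact Finset.sum_eq_zero fun r _ => if_neg (h.ne r)

theorem angle_ne_of_radius_lt {x y : RayedCircle v} (hx : x.angle ≠ μ)
    (h : radius μ x < radius μ y) : x.angle ≠ y.angle := by
  intro e
  rw [radius_of_angle_ne hx, radius_of_angle_ne (e ▸ hx), e] at h
  exact lt_irrefl _ h

theorem radius_pos_of_ne {x : RayedCircle v} (h : slotOf μ x ≠ .arc) : 0 < radius μ x := by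
  have hm := mem_slotOf one_pos μ x
  cases hs : slotOf μ x with
  | arc => exact (h hs).elim
  | cut =>
    rw [hs] at hm
    rw [radius_of_angle_ne hm]
    exact norm_pos_iff.mpr (sub_ne_zero.mpr hm)
  | ray r =>
    rw [hs] at hm
    obtain ⟨rfl, hd⟩ := hm
    rw [radius_of_depth hd.ne']
    exact hd

variable [LinearOrder R]

theorem slotOf_key_lt {x y : RayedCircle v}
    (h : (slotOf μ x).key x < (slotOf μ y).key y) :
    slotOf μ y ≠ .arc ∧ (slotOf μ x).Rel μ (slotOf μ y) x y ∨
      slotOf μ x = .cut ∧ slotOf μ y = .cut := by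
  have hr : slotOf μ x = .arc → slotOf μ y ≠ .arc → radius μ x < radius μ y := by
    intro h1 h2
    rw [angle_of_slotOf_arc h1, radius_circlePt, sub_self, norm_zero]
    exact radius_pos_of_ne h2
  revert hr h
  cases slotOf μ x <;> cases slotOf μ y <;>
    simp [Slot.key, Slot.Rel, Prod.Lex.toLex_lt_toLex]

/-- A configuration with two particles over the same point of the circle fits a pattern there. -/
theorem exists_perm_of_angle_eq (hε : 0 < ε) (hx : Function.Injective x) {i j : Fin 3}
    (hij : i ≠ j) (hi : (x i).angle = μ) (hj : (x j).angle = μ) :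
    ∃ σ : Equiv.Perm (Fin 3), x ∘ σ ∈ PatternUnion v ε (cutPatterns m) ∨
      x ∘ σ ∈ PatternUnion v ε starPatterns := by
  obtain ⟨σ, hσ⟩ := exists_perm_strictMono (key_injective hx hij hi hj)
  have hlt : ∀ k l, k < l → slotOf μ (x (σ l)) ≠ .arc ∧
      (slotOf μ (x (σ k))).Rel μ (slotOf μ (x (σ l))) (x (σ k)) (x (σ l)) := by
    intro k l hkl
    refine (slotOf_key_lt (hσ hkl)).resolve_right ?_
    rintro ⟨h1, h2⟩
    rw [slotOf_eq_cut_iff] at h1 h2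
    rcases exists_eq_of_pairs i j (σ k) (σ l) hij (σ.injective.ne hkl.ne) with
      rfl | rfl | rfl | rfl
    exacts [h1 hi, h2 hi, h1 hj, h2 hj]
  have hne : ∀ k, k ≠ 0 → slotOf μ (x (σ k)) ≠ .arc := fun k hk =>
    (hlt 0 k (Fin.pos_of_ne_zero hk)).1
  have hmem : x ∘ σ ∈ Pattern v ε μ (fun k => slotOf μ (x (σ k))) univ :=
    ⟨⟨fun k => mem_slotOf hε μ _, fun k l hkl => (hlt k l hkl).2⟩, mem_univ _⟩
  have hray : ∀ k, slotOf μ (x (σ k)) ≠ .arc → (x (σ k)).angle = μ →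
      ∃ r, slotOf μ (x (σ k)) = .ray r := by
    intro k h1 h2
    cases h : slotOf μ (x (σ k)) with
    | arc => exact (h1 h).elim
    | cut => exact (slotOf_eq_cut_iff.mp h h2).elim
    | ray r => exact ⟨r, rfl⟩
  obtain ⟨k, rfl⟩ := σ.surjective i
  obtain ⟨l, rfl⟩ := σ.surjective j
  refine ⟨σ, ?_⟩
  simp only [mem_patternUnion]
  -- If a particle sits at the centre, another one over the centre is on a ray and, as rays come
  -- last, the final place is a ray: the star family. Otherwise both particles over the centre are
  -- on rays: the cut family.
  by_cases h0 : slotOf μ (x (σ 0)) = .arc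
  · refine Or.inr ⟨μ, _, ⟨h0, ?_⟩, hmem⟩
    have hr : (∃ r, slotOf μ (x (σ 1)) = .ray r) ∨ ∃ r, slotOf μ (x (σ 2)) = .ray r := by
      have h1 := hray k
      have h2 := hray l
      have hkl : k ≠ l := fun e => hij (by rw [e])
      fin_cases k <;> fin_cases l <;> simp_all
    have hrel := (hlt 1 2 (by decide)).2
    have n1 := hne 1 (by decide)
    have n2 := hne 2 (by decide)
    revert hr hrel n1 n2
    dsimp only
    cases slotOf μ (x (σ 1)) <;> cases slotOf μ (x (σ 2)) <;> simp [Slot.Rel]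
  · have hall : ∀ k, slotOf μ (x (σ k)) ≠ .arc := fun k => by
      by_cases hk : k = 0
      exacts [hk ▸ h0, hne k hk]
    exact Or.inl ⟨μ, _, Or.inr ⟨hall, k, l, fun e => hij (by rw [e]), hray k (hall k) hi,
      hray l (hall l) hj⟩, hmem⟩

/-- Sort the particles along the circle cut open at `m`; a particle over `m` has coordinate 0 and so
comes first. -/
theorem exists_perm_of_angle_injective (h : IsSeparated v m ε)
    (hx : Function.Injective fun i => (x i).angle) :
    ∃ σ : Equiv.Perm (Fin 3),
      ((∀ i, (x i).angle ≠ m) → x ∘ σ ∈ PatternUnion v ε (cutPatterns m)) ∧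
      ((∃ i, (x i).angle = m) → x ∘ σ ∈ PatternUnion v ε (basePatterns m)) := by
  have hinj : Function.Injective fun i => cutCoord ((x i).angle - m) := fun i j hij =>
    hx (sub_left_injective (cutCoord_injective hij))
  obtain ⟨σ, hσ⟩ := exists_perm_strictMono hinj
  have hne : ∀ k, k ≠ 0 → (x (σ k)).angle ≠ m := by
    intro k hk e
    have := hσ (Fin.pos_of_ne_zero hk)
    simp only [Function.comp_apply, e, sub_self, cutCoord_eq_zero_iff.mpr] at this
    exact (cutCoord_nonneg _).not_gt this
  refine ⟨σ, fun hall => mem_patternUnion.mpr ⟨m, fun _ => .cut, Or.inl ⟨rfl, fun _ => rfl⟩,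
    ⟨fun k => hall (σ k), fun k l hkl => hσ hkl⟩, mem_univ _⟩, ?_⟩
  rintro ⟨i, hi⟩
  obtain ⟨k, rfl⟩ := σ.surjective i
  obtain rfl : k = 0 := by_contra fun hk => hne k hk hi
  rw [mem_patternUnion]
  refine ⟨m, _, rfl, ⟨fun k => ?_, fun k l hkl => ?_⟩, mem_univ _⟩
  · fin_cases k
    · show ‖(x (σ 0)).angle - m‖ < ε
      rw [hi, sub_self, norm_zero]
      exact h.pos
    · exact hne 1 (by decide)
    · exact hne 2 (by decide)
  · have hr : ∀ l, l ≠ 0 → radius m (x (σ 0)) < radius m (x (σ l)) := fun l hl => by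
      rw [h.radius_eq, h.radius_eq, hi, sub_self, norm_zero, norm_pos_iff, sub_ne_zero]
      exact hne l hl
    fin_cases k <;> fin_cases l <;> try exact absurd hkl (by decide)
    · exact hr 1 (by decide)
    · exact hr 2 (by decide)
    · exact hσ hkl

end RayedCircle

/-! ### The left and right parts of the overlaps -/

namespace RayedCircle

variable {R : Type} [Fintype R] [LinearOrder R] {v : R → UnitAddCircle} {ε : ℝ}
  {m μ : UnitAddCircle} {x : Fin 3 → RayedCircle v} {σ : Equiv.Perm (Fin 3)}

/-- Configurations with a particle near `m` whose coordinate is in a given set. -/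
def baseHalf (v : R → UnitAddCircle) (ε : ℝ) (m : UnitAddCircle) (I : Set ℝ) :
    Set (Fin 3 → RayedCircle v) :=
  Pattern v ε m ![.arc, .cut, .cut] {t | t 0 ∈ I}

/-- Configurations with one particle off the centre, in which the order on the circle cut open
at `m` of the centre and of that particle is prescribed. -/
def starHalf (v : R → UnitAddCircle) (ε : ℝ) (m : UnitAddCircle) (r : ℝ → ℝ → Prop) :
    Set (Fin 3 → RayedCircle v) :=
  {x | ∃ μ s, (μ, s) ∈ starPatterns ∧ s 1 = .cut ∧ x ∈ Pattern v ε μ s univ ∧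
    ((x 0).angle ≠ μ ∧ (x 1).angle ≠ m) ∧ r (cutCoord (μ - m)) (cutCoord ((x 1).angle - m))}

/-- Configurations with two particles on rays at a centre. -/
def starRest (v : R → UnitAddCircle) (ε : ℝ) : Set (Fin 3 → RayedCircle v) :=
  {x | ∃ μ s, (μ, s) ∈ starPatterns ∧ x ∈ Pattern v ε μ s univ ∧
    ((∃ r, s 1 = .ray r) ∨ ∃ r, v r = μ ∧ 0 < (x 0).depth r)}

/-- The configurations that leave their pattern to the left. -/
def leftPart (v : R → UnitAddCircle) (ε : ℝ) (m : UnitAddCircle) : Set (Fin 3 → RayedCircle v) :=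
  baseHalf v ε m (Iio 0) ∪ starHalf v ε m (· < ·)

/-- The configurations that leave their pattern to the right or along the rays. -/
def rightPart (v : R → UnitAddCircle) (ε : ℝ) (m : UnitAddCircle) : Set (Fin 3 → RayedCircle v) :=
  baseHalf v ε m (Ioi 0) ∪ starHalf v ε m (· > ·) ∪ starRest v ε

theorem Pattern.mono {s : Fin 3 → Slot R} {C C' : Set (Fin 3 → ℝ)} (h : C ⊆ C') :
    Pattern v ε μ s C ⊆ Pattern v ε μ s C' :=
  fun _ hx => ⟨hx.1, h hx.2⟩

theorem mem_patternUnion_base : x ∈ PatternUnion v ε (basePatterns m) ↔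
    x ∈ Pattern v ε m ![.arc, .cut, .cut] univ := by
  rw [mem_patternUnion]
  constructor
  · rintro ⟨μ, s, hκ, hx⟩
    obtain ⟨h1, h2⟩ := Prod.ext_iff.mp hκ
    dsimp only at h1 h2
    rwa [h1, h2] at hx
  · exact fun hx => ⟨m, _, rfl, hx⟩

theorem baseHalf_subset {I : Set ℝ} : baseHalf v ε m I ⊆ PatternUnion v ε (basePatterns m) :=
  fun _ hx => mem_patternUnion_base.mpr (Pattern.mono (subset_univ _) hx)

theorem isOpen_baseHalf (hε : ε ≤ 1 / 4) {I : Set ℝ} (hI : IsOpen I) :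
    IsOpen (baseHalf v ε m I) :=
  Pattern.isOpen hε (hI.preimage (continuous_apply 0))

theorem isPreconnected_baseHalf (hε : ε ≤ 1 / 4) {I : Set ℝ} (hI : Convex ℝ I) :
    IsPreconnected (baseHalf v ε m I) := by
  rcases (baseHalf v ε m I).eq_empty_or_nonempty with h | h
  · rw [h]
    exact isPreconnected_empty
  · have : ContractibleSpace (baseHalf v ε m I) := Pattern.contractibleSpace hε
      (hI.linear_preimage (LinearMap.proj (R := ℝ) (φ := fun _ : Fin 3 => ℝ) 0)) h
    exact isPreconnected_iff_preconnectedSpace.mpr inferInstance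

theorem isOpen_starHalf (hε : ε ≤ 1 / 4) {r : ℝ → ℝ → Prop}
    (hr : ∀ a b, r a b → ∀ᶠ b' in 𝓝 b, r a b') : IsOpen (starHalf v ε m r) := by
  rw [isOpen_iff_mem_nhds]
  rintro x ⟨μ, s, hs, h1, hx, ⟨h2, h3⟩, h4⟩
  have ha : ∀ i, Continuous fun x : Fin 3 → RayedCircle v => (x i).angle := fun i =>
    continuous_angle.comp (continuous_apply i)
  have c : ContinuousAt (fun x : Fin 3 → RayedCircle v => cutCoord ((x 1).angle - m)) x :=
    ContinuousAt.comp (f := fun x : Fin 3 → RayedCircle v => (x 1).angle - m)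
      (continuousAt_cutCoord (sub_ne_zero.mpr h3))
      ((ha 1).sub continuous_const).continuousAt
  filter_upwards [(Pattern.isOpen hε isOpen_univ).mem_nhds hx, (ha 0).continuousAt.eventually_ne h2,
    (ha 1).continuousAt.eventually_ne h3, c.eventually (hr _ _ h4)] with y k1 k2 k3 k4
  exact ⟨μ, s, hs, h1, k1, ⟨k2, k3⟩, k4⟩

theorem isOpen_starRest (hε : ε ≤ 1 / 4) : IsOpen (starRest v ε) := by
  rw [isOpen_iff_mem_nhds]
  rintro x ⟨μ, s, hs, hx, h⟩
  have hp := (Pattern.isOpen hε isOpen_univ).mem_nhds hx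
  rcases h with h | ⟨r, hr, h⟩
  · filter_upwards [hp] with y hy using ⟨μ, s, hs, hy, Or.inl h⟩
  · have c : Continuous fun x : Fin 3 → RayedCircle v => (x 0).depth r :=
      (continuous_depth r).comp (continuous_apply 0)
    filter_upwards [hp, c.continuousAt.eventually_const_lt h] with y hy hy' using
      ⟨μ, s, hs, hy, Or.inr ⟨r, hr, hy'⟩⟩

theorem isOpen_leftPart (hε : ε ≤ 1 / 4) : IsOpen (leftPart v ε m) :=
  (isOpen_baseHalf hε isOpen_Iio).union (isOpen_starHalf hε fun _ _ h => lt_mem_nhds h)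

theorem isOpen_rightPart (hε : ε ≤ 1 / 4) : IsOpen (rightPart v ε m) :=
  ((isOpen_baseHalf hε isOpen_Ioi).union (isOpen_starHalf hε fun _ _ h => gt_mem_nhds h)).union
    (isOpen_starRest hε)

theorem angle_injective_of_base (h : IsSeparated v m ε)
    (hx : x ∈ PatternUnion v ε (basePatterns m)) : Function.Injective fun i => (x i).angle := by
  have hx := mem_patternUnion_base.mp hx
  have h1 : radius m (x 0) < radius m (x 1) := hx.1.2 0 1 (by decide)
  have h2 : radius m (x 0) < radius m (x 2) := hx.1.2 0 2 (by decide)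
  have h3 : cutCoord _ < cutCoord _ := hx.1.2 1 2 (by decide)
  rw [h.radius_eq, h.radius_eq] at h1 h2
  exact angle_injective_of_three (fun e => by simp [e] at h1) (fun e => by simp [e] at h2)
    fun e => by simp [e] at h3

theorem angle_injective_of_star {s : Fin 3 → Slot R} (hs : (μ, s) ∈ starPatterns)
    (h1 : s 1 = .cut) (hx : x ∈ Pattern v ε μ s univ) (h0 : (x 0).angle ≠ μ) :
    Function.Injective fun i => (x i).angle := by
  obtain ⟨hs0, -, r, hs2⟩ := hs
  have k := hx.1.2 0 1 (by decide)
  have m1 := hx.1.1 1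
  have m2 := hx.1.1 2
  dsimp only at hs0 hs2
  rw [hs0] at k
  rw [h1] at m1
  rw [hs2] at m2
  have m2 := Slot.angle_eq_of_mem_ray m2
  refine angle_injective_of_three (angle_ne_of_radius_lt h0 (Slot.radius_lt_of_rel_arc k)) ?_ ?_
  · rw [m2]
    exact h0
  · rw [m2]
    exact m1

theorem angle_injective_of_leftPart (h : IsSeparated v m ε) (hx : x ∈ leftPart v ε m) :
    Function.Injective fun i => (x i).angle := by
  rcases hx with hx | ⟨μ, s, hs, h1, hx, ⟨h2, -⟩, -⟩
  · exact angle_injective_of_base h (baseHalf_subset hx)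
  · exact angle_injective_of_star hs h1 hx h2

theorem not_angle_injective_of_starRest (hx : x ∈ starRest v ε) :
    ¬ Function.Injective fun i => (x i).angle := by
  obtain ⟨μ, s, ⟨-, -, r, hs2⟩, hx, h⟩ := hx
  intro hinj
  have m2 := hx.1.1 2
  dsimp only at hs2
  rw [hs2] at m2
  have m2 := Slot.angle_eq_of_mem_ray m2
  rcases h with ⟨r', h⟩ | ⟨r', rfl, h⟩
  · have m1 := hx.1.1 1
    rw [h] at m1
    exact absurd (hinj ((Slot.angle_eq_of_mem_ray m1).trans m2.symm)) (by decide)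
  · exact absurd (hinj ((angle_eq_of_depth h.ne').trans m2.symm)) (by decide)

/-- In a configuration near a centre on the circle only the free particle can be near `m`. -/
theorem eq_one_of_norm_lt (h : IsSeparated v m ε) {s : Fin 3 → Slot R}
    (hs : (μ, s) ∈ starPatterns) (hx : x ∈ Pattern v ε μ s univ) {j : Fin 3}
    (hj : ‖(x j).angle - m‖ < ε) : j = 1 ∧ ε < cutCoord (μ - m) ∧ cutCoord (μ - m) < 1 - ε := by
  obtain ⟨hs0, -, r, hs2⟩ := hs
  have m0 := hx.1.1 0
  have m2 := hx.1.1 2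
  dsimp only at hs0 hs2
  rw [hs0] at m0
  rw [hs2] at m2
  have m0 : ‖(x 0).angle - μ‖ < ε := m0
  have hb := h.base r
  rw [m2.1] at hb
  have m2 := Slot.angle_eq_of_mem_ray m2
  have hε := h.pos
  refine ⟨?_, ?_⟩
  · fin_cases j
    · have hj : ‖(x 0).angle - m‖ < ε := hj
      have := norm_sub_le_norm_sub_add_norm_sub μ (x 0).angle m
      rw [norm_sub_rev μ (x 0).angle] at this
      linarith
    · rfl
    · have hj : ‖(x 2).angle - m‖ < ε := hj
      rw [m2] at hj
      linarith
  · rw [norm_eq_min_cutCoord, le_min_iff] at hb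
    constructor <;> linarith

theorem norm_lt_of_baseHalf {I : Set ℝ} (hx : x ∈ baseHalf v ε m I) :
    ‖(x 0).angle - m‖ < ε ∧ arcCoord ((x 0).angle - m) ∈ I :=
  ⟨hx.1.1 0, hx.2⟩

theorem cutCoord_of_left {z : UnitAddCircle} (h : ‖z‖ < ε) (h' : arcCoord z < 0) :
    1 - ε < cutCoord z := by
  rw [norm_eq_abs_arcCoord, abs_lt] at h
  rw [cutCoord_of_arcCoord_neg h']
  linarith

theorem cutCoord_of_right {z : UnitAddCircle} (h : ‖z‖ < ε) (h' : 0 < arcCoord z) :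
    cutCoord z < ε := by
  rw [norm_eq_abs_arcCoord, abs_lt] at h
  rw [cutCoord_of_arcCoord_nonneg h'.le]
  exact h.2

/-- The two tests for the side agree where both apply. By `eq_one_of_norm_lt` the particle near `m`
is then the free one, and the centre has coordinate between `ε` and `1 - ε`. To the left of `m` the
free particle has coordinate above `1 - ε`, after the centre; to the right it is below `ε`, before
the centre. Configurations in `starRest` have two particles over one point and are thus never left.
-/
theorem not_mem_rightPart (h : IsSeparated v m ε) (hx : x ∈ leftPart v ε m) :
    x ∘ σ ∉ rightPart v ε m := by
  have hinj := angle_injective_of_leftPart h hx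
  rintro ((hx' | ⟨μ', s', hs', h1', hx', ⟨h2', h3'⟩, h4'⟩) | hx')
  · have b' := norm_lt_of_baseHalf hx'
    rcases hx with hx | ⟨μ, s, hs, h1, hx, ⟨h2, h3⟩, h4⟩
    · have b := norm_lt_of_baseHalf hx
      have := (isRigid_basePatterns m x σ _ rfl _ rfl (Pattern.mono (subset_univ _) hx)
        (Pattern.mono (subset_univ _) hx')).1
      subst this
      exact lt_asymm (mem_Iio.mp b.2) (mem_Ioi.mp b'.2)
    · obtain ⟨e, k1, k2⟩ := eq_one_of_norm_lt h hs hx b'.1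
      have k3 := cutCoord_of_right b'.1 b'.2
      simp only [Function.comp_apply, e] at k3
      linarith
  · rcases hx with hx | ⟨μ, s, hs, h1, hx, ⟨h2, h3⟩, h4⟩
    · have b := norm_lt_of_baseHalf hx
      have e0 : x 0 = (x ∘ σ) (σ.symm 0) := by simp
      obtain ⟨e, k1, k2⟩ := eq_one_of_norm_lt h hs' hx' (e0 ▸ b.1)
      have k3 := cutCoord_of_left b.1 b.2
      rw [e0, e] at k3
      linarith
    · obtain ⟨e1, e2⟩ := isRigid_starPatterns h x σ _ hs _ hs' hx hx'
      subst e1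
      obtain ⟨rfl, rfl⟩ := Prod.ext_iff.mp e2
      exact lt_asymm h4 h4'
  · refine not_angle_injective_of_starRest hx' (hinj.comp σ.injective)

theorem angle_ne_of_base_of_cut (h : IsSeparated v m ε)
    (hx : x ∈ PatternUnion v ε (basePatterns m))
    (hx' : x ∘ σ ∈ PatternUnion v ε (cutPatterns m)) (i : Fin 3) : (x i).angle ≠ m := by
  have hinj := angle_injective_of_base h hx
  obtain ⟨μ, s, hκ, hp⟩ := mem_patternUnion.mp hx'
  rcases hκ with ⟨e, hs⟩ | ⟨-, i, j, hij, ⟨r, hi⟩, r', hj⟩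
  · have := hp.1.1 (σ.symm i)
    dsimp only at e hs this
    rw [hs] at this
    rw [← e]
    have : (x (σ (σ.symm i))).angle ≠ μ := this
    rwa [Equiv.apply_symm_apply] at this
  · have k1 := hp.1.1 i
    have k2 := hp.1.1 j
    dsimp only at hi hj
    rw [hi] at k1
    rw [hj] at k2
    exact (hij (σ.injective (hinj ((Slot.angle_eq_of_mem_ray k1).trans
      (Slot.angle_eq_of_mem_ray k2).symm)))).elim

theorem mem_baseHalf_of_cut (h : IsSeparated v m ε)
    (hx : x ∈ PatternUnion v ε (basePatterns m))
    (hx' : x ∘ σ ∈ PatternUnion v ε (cutPatterns m)) :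
    x ∈ baseHalf v ε m (Iio 0) ∨ x ∈ baseHalf v ε m (Ioi 0) := by
  have hne := angle_ne_of_base_of_cut h hx hx' 0
  have hx := mem_patternUnion_base.mp hx
  have : arcCoord ((x 0).angle - m) ≠ 0 := by
    intro e
    have := coe_arcCoord ((x 0).angle - m)
    rw [e] at this
    exact hne (sub_eq_zero.mp this.symm)
  exact (lt_or_gt_of_ne this).imp (fun k => ⟨hx.1, k⟩) fun k => ⟨hx.1, k⟩

/-- If particle 0 is off the centre, the angles are distinct, so the pattern is the one cut at `m`
and the centre can be compared with the free particle. If it is over the centre along with particle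
2, the cut pattern must have two particles on rays, at the same centre. -/
theorem mem_star_of_cut (h : IsSeparated v m ε) (hx : x ∈ PatternUnion v ε starPatterns)
    (hx' : x ∘ σ ∈ PatternUnion v ε (cutPatterns m)) :
    x ∈ leftPart v ε m ∨ x ∈ rightPart v ε m := by
  obtain ⟨μ, s, hs, hx⟩ := mem_patternUnion.mp hx
  obtain ⟨μ', s', hκ, hp⟩ := mem_patternUnion.mp hx'
  have hs' := hs
  obtain ⟨hs0, hs1, r, hs2⟩ := hs'
  have m1 := hx.1.1 1
  have m2 := hx.1.1 2
  have k01 := hx.1.2 0 1 (by decide)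
  dsimp only at hs0 hs1 hs2
  rw [hs0] at k01
  have k01 := Slot.radius_lt_of_rel_arc k01
  rw [hs2] at m2
  rcases hs1 with hs1 | hs1
  · rw [hs1] at m1
    by_cases h0 : (x 0).angle = μ
    · refine Or.inr (Or.inr ⟨μ, s, hs, hx, Or.inr ?_⟩)
      rcases hκ with ⟨e, hc⟩ | ⟨-, i, j, hij, ⟨ri, hi⟩, rj, hj⟩
      · have := Pattern.angle_injective_of_cut hc hp
        refine absurd (σ.symm.injective (this (a₁ := σ.symm 0) (a₂ := σ.symm 2) ?_)) (by decide)
        simp only [Function.comp_apply, Equiv.apply_symm_apply]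
        rw [h0, Slot.angle_eq_of_mem_ray m2]
      · have p1 := hp.1.1 i
        have p2 := hp.1.1 j
        dsimp only at hi hj
        rw [hi] at p1
        rw [hj] at p2
        have q1 := Slot.angle_eq_of_mem_ray p1
        have q2 := Slot.angle_eq_of_mem_ray p2
        -- At any other centre only particle 1 could be present, but two particles are needed.
        have hμ : μ = μ' := by
          by_contra hne
          have key : ∀ k, (x k).angle = μ' → k = 1 := by
            intro k hk
            fin_cases k
            · exact (hne (h0.symm.trans hk)).elim
            · rfl
            · exact (hne ((Slot.angle_eq_of_mem_ray m2).symm.trans hk)).elim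
          exact hij (σ.injective ((key _ q1).trans (key _ q2).symm))
        subst hμ
        have : σ i = 0 ∨ σ j = 0 := by
          have e1 : σ i ≠ 1 := fun e => m1 (e ▸ q1)
          have e2 : σ j ≠ 1 := fun e => m1 (e ▸ q2)
          have e3 := σ.injective.ne hij
          generalize σ i = a at *
          generalize σ j = b at *
          fin_cases a <;> fin_cases b <;> simp_all
        rcases this with e | e
        · exact ⟨ri, p1.1, e ▸ p1.2⟩
        · exact ⟨rj, p2.1, e ▸ p2.2⟩
    · have hinj := angle_injective_of_star hs hs1 hx h0
      rcases hκ with ⟨e, hc⟩ | ⟨-, i, j, hij, ⟨ri, hi⟩, rj, hj⟩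
      · have hne : (x 1).angle ≠ μ' := by
          have := hp.1.1 (σ.symm 1)
          dsimp only at this hc
          rw [hc] at this
          have : (x (σ (σ.symm 1))).angle ≠ μ' := this
          rwa [Equiv.apply_symm_apply] at this
        dsimp only at e
        subst e
        have hcut : cutCoord (μ - μ') ≠ cutCoord ((x 1).angle - μ') := fun e =>
          m1 (sub_left_injective (cutCoord_injective e)).symm
        rcases lt_or_gt_of_ne hcut with k | k
        · exact Or.inl (Or.inr ⟨μ, s, hs, hs1, hx, ⟨h0, hne⟩, k⟩)
        · exact Or.inr (Or.inl (Or.inr ⟨μ, s, hs, hs1, hx, ⟨h0, hne⟩, k⟩))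
      · have p1 := hp.1.1 i
        have p2 := hp.1.1 j
        dsimp only at hi hj
        rw [hi] at p1
        rw [hj] at p2
        exact (hij (σ.injective (hinj ((Slot.angle_eq_of_mem_ray p1).trans
          (Slot.angle_eq_of_mem_ray p2).symm)))).elim
  · exact Or.inr (Or.inr ⟨μ, s, hs, hx, Or.inl hs1⟩)

theorem exists_perm_cut_of_baseHalf (h : IsSeparated v m ε) {I : Set ℝ} (hI : (0 : ℝ) ∉ I)
    (hx : x ∈ baseHalf v ε m I) : ∃ σ : Equiv.Perm (Fin 3),
      x ∘ σ ∈ PatternUnion v ε (cutPatterns m) := by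
  obtain ⟨σ, hσ, -⟩ := exists_perm_of_angle_injective h
    (angle_injective_of_base h (baseHalf_subset hx))
  refine ⟨σ, hσ fun i => ?_⟩
  fin_cases i
  · intro e
    have h1 := (norm_lt_of_baseHalf hx).2
    change (x 0).angle = m at e
    rw [e, sub_self] at h1
    exact hI ((arcCoord_coe (t := 0) (by norm_num) (by norm_num)) ▸ h1)
  · exact hx.1.1 1
  · exact hx.1.1 2

theorem exists_perm (h : IsSeparated v m ε) (hx : Function.Injective x) :
    ∃ σ : Equiv.Perm (Fin 3), x ∘ σ ∈ PatternUnion v ε (cutPatterns m) ∨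
      x ∘ σ ∈ PatternUnion v ε (basePatterns m) ∨ x ∘ σ ∈ PatternUnion v ε starPatterns := by
  by_cases hinj : Function.Injective fun i => (x i).angle
  · obtain ⟨σ, h1, h2⟩ := exists_perm_of_angle_injective h hinj
    by_cases hm : ∃ i, (x i).angle = m
    · exact ⟨σ, Or.inr (Or.inl (h2 hm))⟩
    · exact ⟨σ, Or.inl (h1 (not_exists.mp hm))⟩
  · obtain ⟨i, j, hij, hne⟩ : ∃ i j, (x i).angle = (x j).angle ∧ i ≠ j := by
      simpa [Function.Injective] using hinj
    obtain ⟨σ, hσ⟩ := exists_perm_of_angle_eq h.pos hx hne rfl hij.symm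
    exact ⟨σ, hσ.imp_right Or.inr⟩

/-- Together with `inter_diff_left` this identifies the two pieces of `U₀ ∩ U₁` with images of
single patterns, which are connected. -/
theorem inter_inter_left (h : IsSeparated v m ε) :
    confImage (PatternUnion v ε (cutPatterns m)) ∩ confImage (PatternUnion v ε (basePatterns m)) ∩
      confImage (leftPart v ε m) = confImage (baseHalf v ε m (Iio 0)) := by
  ext c
  constructor
  · rintro ⟨⟨h0, ⟨p, hp, rfl⟩⟩, hl⟩
    obtain ⟨σ, hσ⟩ := mk_mem_confImage.mp h0
    rcases mem_baseHalf_of_cut h hp hσ with k | k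
    · exact ⟨p, k, rfl⟩
    · obtain ⟨τ, hτ⟩ := mk_mem_confImage.mp hl
      refine (not_mem_rightPart (σ := τ.symm) h hτ ?_).elim
      rw [Function.comp_assoc, Equiv.self_comp_symm]
      exact Or.inl (Or.inl k)
  · rintro ⟨p, hp, rfl⟩
    exact ⟨⟨mk_mem_confImage.mpr (exists_perm_cut_of_baseHalf h self_notMem_Iio hp),
      ⟨p, baseHalf_subset hp, rfl⟩⟩, ⟨p, Or.inl hp, rfl⟩⟩

theorem inter_diff_left (h : IsSeparated v m ε) :
    (confImage (PatternUnion v ε (cutPatterns m)) ∩ confImage (PatternUnion v ε (basePatterns m))) \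
      confImage (leftPart v ε m) = confImage (baseHalf v ε m (Ioi 0)) := by
  ext c
  constructor
  · rintro ⟨⟨h0, ⟨p, hp, rfl⟩⟩, hl⟩
    obtain ⟨σ, hσ⟩ := mk_mem_confImage.mp h0
    rcases mem_baseHalf_of_cut h hp hσ with k | k
    · exact (hl ⟨p, Or.inl k, rfl⟩).elim
    · exact ⟨p, k, rfl⟩
  · rintro ⟨p, hp, rfl⟩
    refine ⟨⟨mk_mem_confImage.mpr (exists_perm_cut_of_baseHalf h self_notMem_Ioi hp),
      ⟨p, baseHalf_subset hp, rfl⟩⟩, fun hl => ?_⟩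
    obtain ⟨τ, hτ⟩ := mk_mem_confImage.mp hl
    refine (not_mem_rightPart (σ := τ.symm) h hτ ?_).elim
    rw [Function.comp_assoc, Equiv.self_comp_symm]
    exact Or.inl (Or.inl hp)

theorem isFreeGroup_of_isSeparated (h : IsSeparated v m ε)
    [LocallyPathConnectedSpace (RayedCircle v)] (c : Conf 3 (RayedCircle v)) :
    IsFreeGroup (FundamentalGroup (Conf 3 (RayedCircle v)) c) := by
  refine isFreeGroup_fundamentalGroup_of_three_sets
    (L := confImage (leftPart v ε m))
    (isOpen_confImage (isOpen_patternUnion h.le (cutPatterns m)))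
    (isOpen_confImage (isOpen_patternUnion h.le (basePatterns m)))
    (isOpen_confImage (isOpen_patternUnion h.le starPatterns)) ?_
    ((isRigid_cutPatterns m).loopsNull h.le) ((isRigid_basePatterns m).loopsNull h.le)
    ((isRigid_starPatterns h).loopsNull h.le) ?_ ?_ ?_ c
  · rintro ⟨p⟩
    obtain ⟨σ, hσ⟩ := exists_perm h p.2
    exact hσ.imp (fun k => mk_mem_confImage.mpr ⟨σ, k⟩)
      (Or.imp (fun k => mk_mem_confImage.mpr ⟨σ, k⟩) fun k => mk_mem_confImage.mpr ⟨σ, k⟩)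
  · have hdisj : ∀ c, c ∈ confImage (rightPart v ε m) → c ∉ confImage (leftPart v ε m) := by
      rintro _ ⟨p, hp, rfl⟩ hl
      obtain ⟨τ, hτ⟩ := mk_mem_confImage.mp hl
      refine not_mem_rightPart (σ := τ.symm) h hτ ?_
      rwa [Function.comp_assoc, Equiv.self_comp_symm]
    have hlr : ∀ c, c ∈ confImage (leftPart v ε m) ∨ c ∈ confImage (rightPart v ε m) →
        ∀ᶠ d in 𝓝 c, (d ∈ confImage (leftPart v ε m) ↔ c ∈ confImage (leftPart v ε m)) := by
      rintro c (hc | hc)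
      · filter_upwards [(isOpen_confImage (isOpen_leftPart h.le)).mem_nhds hc] with d hd
        exact iff_of_true hd hc
      · filter_upwards [(isOpen_confImage (isOpen_rightPart h.le)).mem_nhds hc] with d hd
        exact iff_of_false (hdisj d hd) (hdisj c hc)
    rintro c ⟨h0, ⟨p, hp, rfl⟩ | ⟨p, hp, rfl⟩⟩
    · obtain ⟨σ, hσ⟩ := mk_mem_confImage.mp h0
      refine hlr _ ((mem_baseHalf_of_cut h hp hσ).imp ?_ ?_)
      · exact fun k => ⟨p, Or.inl k, rfl⟩
      · exact fun k => ⟨p, Or.inl (Or.inl k), rfl⟩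
    · obtain ⟨σ, hσ⟩ := mk_mem_confImage.mp h0
      refine hlr _ ((mem_star_of_cut h hp hσ).imp ?_ ?_)
      · exact fun k => ⟨p, k, rfl⟩
      · exact fun k => ⟨p, k, rfl⟩
  · rw [inter_inter_left h]
    exact isPreconnected_confImage (fun x hx => Pattern.injective hx)
      (isPreconnected_baseHalf h.le (convex_Iio 0))
  · rw [inter_diff_left h]
    exact isPreconnected_confImage (fun x hx => Pattern.injective hx)
      (isPreconnected_baseHalf h.le (convex_Ioi 0))

theorem exists_isSeparated {R : Type} [Finite R] (v : R → UnitAddCircle) :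
    ∃ m ε, IsSeparated v m ε := by
  have : Infinite UnitAddCircle :=
    (AddCircle.equivIco (1 : ℝ) 0).infinite_iff.mpr (Ico_infinite (by norm_num)).to_subtype
  obtain ⟨m, hm⟩ := (finite_range v).exists_notMem
  have small : ∀ a : ℝ, 0 < a → ∀ᶠ ε in 𝓝[>] (0 : ℝ), ε ≤ a := fun a ha =>
    nhdsWithin_le_nhds ((gt_mem_nhds ha).mono fun _ h => h.le)
  have h1 : ∀ᶠ ε in 𝓝[>] (0 : ℝ), ∀ r, ε ≤ ‖v r - m‖ / 2 := by
    refine Filter.eventually_all.mpr fun r => small _ (half_pos (norm_pos_iff.mpr ?_))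
    exact sub_ne_zero.mpr fun e => hm ⟨r, e⟩
  have h2 : ∀ᶠ ε in 𝓝[>] (0 : ℝ), ∀ r s, v r ≠ v s → ε ≤ ‖v r - v s‖ / 2 := by
    refine Filter.eventually_all.mpr fun r => Filter.eventually_all.mpr fun s =>
      Filter.eventually_imp_distrib_left.mpr fun hrs => small _ (half_pos (norm_pos_iff.mpr ?_))
    exact sub_ne_zero.mpr hrs
  obtain ⟨ε, h0, h1, h2, h3⟩ :=
    (eventually_mem_nhdsWithin.and (h1.and (h2.and (small (1 / 4) (by norm_num))))).exists
  exact ⟨m, ε, h0, h3, fun r => by linarith [h1 r], fun r s hrs => by linarith [h2 r s hrs]⟩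

/-- The three-strand braid groups of a circle with finitely many rays are free. -/
theorem isFreeGroup_fundamentalGroup_conf {R : Type} [Finite R] (v : R → UnitAddCircle)
    [LocallyPathConnectedSpace (RayedCircle v)] (c : Conf 3 (RayedCircle v)) :
    IsFreeGroup (FundamentalGroup (Conf 3 (RayedCircle v)) c) := by
  have := Fintype.ofFinite R
  -- Any order will do; it only serves to list particles on different rays.
  let _ : LinearOrder R := IsWellOrder.linearOrder WellOrderingRel
  obtain ⟨m, ε, h⟩ := exists_isSeparated v
  exact isFreeGroup_of_isSeparated h c

end RayedCircle

/-! ### Homeomorphic spaces -/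

theorem Homeomorph.fundamentalGroup_map_injective {X Y : Type*} [TopologicalSpace X]
    [TopologicalSpace Y] (e : X ≃ₜ Y) (x : X) :
    Function.Injective (FundamentalGroup.map (e : C(X, Y)) x) := by
  intro a b
  induction a using Quotient.inductionOn with | _ γ
  induction b using Quotient.inductionOn with | _ γ'
  intro h
  obtain ⟨H⟩ : (γ.map e.continuous).Homotopic (γ'.map e.continuous) := Quotient.exact h
  refine Quotient.sound ⟨⟨⟨⟨fun p => e.symm (H p), e.symm.continuous.comp H.continuous⟩,
    fun t => ?_, fun t => ?_⟩, fun t s hs => ?_⟩⟩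
  · exact (congrArg e.symm (H.apply_zero t)).trans (e.symm_apply_apply _)
  · exact (congrArg e.symm (H.apply_one t)).trans (e.symm_apply_apply _)
  · exact (congrArg e.symm (H.eq_fst t hs)).trans (e.symm_apply_apply _)

theorem Homeomorph.isFreeGroup_fundamentalGroup {X Y : Type*} [TopologicalSpace X]
    [TopologicalSpace Y] (e : X ≃ₜ Y) (h : ∀ y : Y, IsFreeGroup (FundamentalGroup Y y)) (x : X) :
    IsFreeGroup (FundamentalGroup X x) :=
  have := h (e x)
  -- Injectivity suffices, since subgroups of free groups are free.
  IsFreeGroup.ofMulEquiv (MonoidHom.ofInjective (e.fundamentalGroup_map_injective x)).symm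

/-- Homeomorphic spaces have homeomorphic configuration spaces. -/
def Homeomorph.confCongr (k : ℕ) {X Y : Type} [TopologicalSpace X] [TopologicalSpace Y]
    (e : X ≃ₜ Y) : Conf k X ≃ₜ Conf k Y :=
  Homeomorph.Quotient.congr (rX := confSetoid k X) (rY := confSetoid k Y)
    ((Homeomorph.piCongrRight fun _ : Fin k => e).subtype fun _ =>
      (Function.Injective.of_comp_iff e.injective _).symm) fun p q =>
    exists_congr fun σ => by
      constructor
      · intro h
        funext i
        exact congrArg e (congrFun h i)
      · intro h
        funext i
        exact e.injective (congrFun h i)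

/-! ### Realizations of graphs -/

namespace Multigraph

variable (G : Multigraph)

theorem continuous_cells {G : Multigraph} {Y : Type*} [TopologicalSpace Y] {f : G.Cells → Y}
    (h : ∀ e, Continuous fun t => f (Sum.inr (e, t))) : Continuous f := by
  let _ : TopologicalSpace G.V := ⊥
  let _ : TopologicalSpace G.E := ⊥
  have : DiscreteTopology G.V := ⟨rfl⟩
  have : DiscreteTopology G.E := ⟨rfl⟩
  exact continuous_sum_dom.mpr ⟨continuous_of_discreteTopology,
    continuous_prod_of_discrete_left.mpr h⟩

instance [Finite G.V] [Finite G.E] : CompactSpace G.Realization := by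
  let _ : TopologicalSpace G.V := ⊥
  let _ : TopologicalSpace G.E := ⊥
  have : CompactSpace G.Cells := inferInstanceAs (CompactSpace (G.V ⊕ (G.E × unitInterval)))
  exact inferInstanceAs (CompactSpace (Quot G.Glue))

instance : LocallyPathConnectedSpace G.Realization := by
  let _ : TopologicalSpace G.V := ⊥
  let _ : TopologicalSpace G.E := ⊥
  have : DiscreteTopology G.V := ⟨rfl⟩
  have : DiscreteTopology G.E := ⟨rfl⟩
  have : LocallyPathConnectedSpace unitInterval :=
    (convex_Icc (0 : ℝ) 1).locallyPathConnectedSpace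
  have : LocallyPathConnectedSpace G.Cells :=
    inferInstanceAs (LocallyPathConnectedSpace (G.V ⊕ (G.E × unitInterval)))
  exact inferInstanceAs (LocallyPathConnectedSpace (Quot G.Glue))

end Multigraph

/-! ### Sun graphs -/

namespace sunGraph

open RayedCircle

variable {n : ℕ} (x : Fin n → ℕ)

/-- The point of the circle at a given distance from the first vertex, if edges have unit length. -/
noncomputable def cyclePt (n : ℕ) (u : ℝ) : UnitAddCircle := ((u / (2 * n) : ℝ) : UnitAddCircle)

/-- The positions of the rays of a sun graph on the circle. -/
noncomputable def rayPos (r : Σ i : Fin n, Fin (x i)) : UnitAddCircle := cyclePt n (2 * r.1.val)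

theorem continuous_cyclePt : Continuous (cyclePt n) :=
  (AddCircle.continuous_mk' 1).comp (continuous_id.div_const _)

/-- Needed for the last edge of the cycle, whose final vertex wraps around to 0. -/
theorem cyclePt_mod (hn : 1 ≤ n) (j : ℕ) : cyclePt n (j % (2 * n) : ℕ) = cyclePt n j := by
  have h : ((j / (2 * n) : ℕ) : ℝ) + ((j % (2 * n) : ℕ) : ℝ) / (2 * n) = (j : ℝ) / (2 * n) := by
    have h1 : (0 : ℝ) < 2 * n := by positivity
    have h2 : ((2 * n * (j / (2 * n)) + j % (2 * n) : ℕ) : ℝ) = j := by rw [Nat.div_add_mod]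
    push_cast at h2 ⊢
    field_simp
    linarith
  unfold cyclePt
  rw [← h, AddCircle.coe_add, eq_comm, add_eq_right]
  exact (AddCircle.coe_eq_zero_iff 1).mpr ⟨((j / (2 * n) : ℕ) : ℤ), by rw [zsmul_one, Int.cast_natCast]⟩

theorem cyclePt_injOn (hn : 1 ≤ n) : InjOn (cyclePt n) (Ico 0 (2 * n)) := by
  intro a ha b hb h
  have h1 : (0 : ℝ) < 2 * n := by positivity
  have k : ∀ c ∈ Ico (0 : ℝ) (2 * n), cutCoord (cyclePt n c) = c / (2 * n) := fun c hc =>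
    cutCoord_coe (div_nonneg hc.1 h1.le) ((div_lt_one h1).mpr hc.2)
  have := (k a ha).symm.trans ((congrArg cutCoord h).trans (k b hb))
  field_simp at this
  exact this

/-- The parametrization of the circle with rays by the cells of a sun graph. -/
noncomputable def cellPt : (sunGraph x).Cells → RayedCircle (rayPos x)
  | .inl (.inl j) => circlePt (cyclePt n j.val)
  | .inl (.inr r) => rayPt r 1
  | .inr (.inl j, t) => circlePt (cyclePt n (j.val + t))
  | .inr (.inr r, t) => rayPt r t

theorem continuous_cellPt : Continuous (cellPt x) := by
  refine Multigraph.continuous_cells fun e => ?_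
  rcases e with j | r
  · exact continuous_circlePt.comp (continuous_cyclePt.comp
      (continuous_const.add continuous_subtype_val))
  · exact (continuous_rayPt r).comp continuous_subtype_val

theorem rayPt_zero {R : Type} {v : R → UnitAddCircle} (r : R) :
    (rayPt r 0 : RayedCircle v) = circlePt (v r) := by
  ext s
  · rfl
  · simp [rayPt, depth, circlePt]

theorem cellPt_eq_of_glue (hn : 1 ≤ n) {a b : (sunGraph x).Cells} (h : (sunGraph x).Glue a b) :
    cellPt x a = cellPt x b := by
  rcases h with (j | r) | (j | r)
  · show circlePt (cyclePt n (j.val + ((0 : unitInterval) : ℝ))) = circlePt (cyclePt n j.val)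
    simp
  · show rayPt r ((0 : unitInterval) : ℝ) = circlePt (cyclePt n ((2 * r.1.val : ℕ) : ℝ))
    rw [Set.Icc.coe_zero, rayPt_zero]
    simp [rayPos]
  · show circlePt (cyclePt n (j.val + ((1 : unitInterval) : ℝ))) =
      circlePt (cyclePt n (((j.val + 1) % (2 * n) : ℕ) : ℝ))
    rw [cyclePt_mod hn]
    simp
  · rfl

/-- The map from the realization of a sun graph to a circle with rays. -/
noncomputable def toRayedCircle (hn : 1 ≤ n) : (sunGraph x).Realization → RayedCircle (rayPos x) :=
  Quot.lift (cellPt x) fun _ _ => cellPt_eq_of_glue x hn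

/-- The cells without redundant points: the initial points of the edges of the cycle are kept, and
so are the final points of the rays. -/
def IsReduced : (sunGraph x).Cells → Prop
  | .inl _ => False
  | .inr (.inl _, t) => (t : ℝ) < 1
  | .inr (.inr _, t) => 0 < (t : ℝ)

theorem exists_isReduced (a : (sunGraph x).Cells) : ∃ b, IsReduced x b ∧
    (Quot.mk _ a : (sunGraph x).Realization) = Quot.mk _ b := by
  have vertex : ∀ j : Fin (2 * n), ∃ b, IsReduced x b ∧
      (Quot.mk _ (Sum.inl (Sum.inl j)) : (sunGraph x).Realization) = Quot.mk _ b := fun j =>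
    ⟨.inr (.inl j, 0), by simp [IsReduced], (Quot.sound (Multigraph.Glue.src (G := sunGraph x) (.inl j))).symm⟩
  rcases a with (j | r) | ⟨j | r, t⟩
  · exact vertex j
  · exact ⟨.inr (.inr r, 1), by simp [IsReduced], (Quot.sound (Multigraph.Glue.tgt (G := sunGraph x) (.inr r))).symm⟩
  · rcases t.2.2.lt_or_eq with h | h
    · exact ⟨.inr (.inl j, t), h, rfl⟩
    · obtain rfl : t = 1 := Subtype.ext h
      obtain ⟨b, hb, e⟩ := vertex _
      exact ⟨b, hb, (Quot.sound (Multigraph.Glue.tgt (G := sunGraph x) (.inl j))).trans e⟩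
  · rcases t.2.1.lt_or_eq with h | h
    · exact ⟨.inr (.inr r, t), h, rfl⟩
    · obtain rfl : t = 0 := Subtype.ext h.symm
      obtain ⟨b, hb, e⟩ := vertex _
      exact ⟨b, hb, (Quot.sound (Multigraph.Glue.src (G := sunGraph x) (.inr r))).trans e⟩

theorem cellPt_injOn (hn : 1 ≤ n) : InjOn (cellPt x) {a | IsReduced x a} := by
  have mixed : ∀ {r} {t : unitInterval} {z}, 0 < (t : ℝ) →
      (rayPt r t : RayedCircle (rayPos x)) ≠ circlePt z := fun {r t z} ht h => by
    have := congrArg (fun p => p.depth r) h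
    simp only [depth_rayPt t.2.1 t.2.2, depth_circlePt] at this
    exact ht.ne' this
  rintro (a | ⟨j | r, t⟩) ha (b | ⟨k | s, u⟩) hb h
  · exact ha.elim
  · exact ha.elim
  · exact ha.elim
  · exact hb.elim
  · have ht : (t : ℝ) < 1 := ha
    have hu : (u : ℝ) < 1 := hb
    have mem : ∀ (j : Fin (2 * n)) (t : unitInterval), (t : ℝ) < 1 →
        (j.val + t : ℝ) ∈ Ico (0 : ℝ) (2 * n) := fun j t ht => by
      have : ((j.val + 1 : ℕ) : ℝ) ≤ ((2 * n : ℕ) : ℝ) := by exact_mod_cast j.isLt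
      push_cast at this
      exact ⟨add_nonneg (Nat.cast_nonneg _) t.2.1, by linarith⟩
    have e : (j.val + t : ℝ) = k.val + u :=
      cyclePt_injOn hn (mem j t ht) (mem k u hu) (congrArg angle h)
    -- On reduced cells `t < 1`, so the integer part of the position is the index of the edge.
    have e1 : j.val = k.val := by
      have h1 := congrArg Nat.floor e
      rwa [add_comm, Nat.floor_add_natCast t.2.1, add_comm (k.val : ℝ), Nat.floor_add_natCast u.2.1, Nat.floor_eq_zero.mpr ht,
        Nat.floor_eq_zero.mpr hu, zero_add, zero_add] at h1
    obtain rfl := Fin.ext e1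
    obtain rfl : t = u := Subtype.ext (add_left_cancel e)
    rfl
  · exact (mixed hb h.symm).elim
  · exact hb.elim
  · exact (mixed ha h).elim
  · have ht : 0 < (t : ℝ) := ha
    have hr : (rayPt s u : RayedCircle (rayPos x)).depth r = t := by
      have h' : (rayPt r t : RayedCircle (rayPos x)) = rayPt s u := h
      rw [← h', depth_rayPt t.2.1 t.2.2]
    obtain rfl : r = s := by
      by_contra hrs
      rw [depth_rayPt_of_ne _ hrs] at hr
      exact ht.ne hr
    rw [depth_rayPt u.2.1 u.2.2] at hr
    obtain rfl : u = t := Subtype.ext hr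
    rfl

theorem toRayedCircle_injective (hn : 1 ≤ n) : Function.Injective (toRayedCircle x hn) := by
  rintro ⟨a⟩ ⟨b⟩ h
  obtain ⟨a', ha, ea⟩ := exists_isReduced x a
  obtain ⟨b', hb, eb⟩ := exists_isReduced x b
  rw [ea, eb] at h ⊢
  rw [cellPt_injOn x hn ha hb h]

theorem toRayedCircle_surjective (hn : 1 ≤ n) : Function.Surjective (toRayedCircle x hn) := by
  intro p
  rcases eq_circlePt_or_exists_depth p with h | ⟨r, hr⟩
  · have h1 : (0 : ℝ) < 2 * n := by positivity
    set u := 2 * n * cutCoord p.angle with hu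
    have h0 : 0 ≤ u := mul_nonneg h1.le (cutCoord_nonneg _)
    have hlt : u < 2 * n := mul_lt_of_lt_one_right h1 (cutCoord_lt_one _)
    refine ⟨Quot.mk _ (Sum.inr (Sum.inl ⟨⌊u⌋₊, ?_⟩, ⟨u - ⌊u⌋₊, ?_, ?_⟩)), ?_⟩
    · exact (Nat.floor_lt h0).mpr (by exact_mod_cast hlt)
    · exact sub_nonneg.mpr (Nat.floor_le h0)
    · linarith [Nat.lt_floor_add_one u]
    · show circlePt (cyclePt n (⌊u⌋₊ + (u - ⌊u⌋₊))) = p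
      rw [add_sub_cancel, cyclePt, hu, mul_div_cancel_left₀ _ h1.ne', coe_cutCoord, ← h]
  · exact ⟨Quot.mk _ (Sum.inr (Sum.inr r, ⟨p.depth r, p.depth_nonneg r, p.depth_le_one r⟩)),
      rayPt_depth hr.ne'⟩

/-- The realization of a sun graph is a circle with rays. -/
noncomputable def homeomorphRayedCircle (hn : 1 ≤ n) :
    (sunGraph x).Realization ≃ₜ RayedCircle (rayPos x) :=
  have : Finite (sunGraph x).V := inferInstanceAs (Finite (Fin (2 * n) ⊕ (Σ i : Fin n, Fin (x i))))
  have : Finite (sunGraph x).E := inferInstanceAs (Finite (Fin (2 * n) ⊕ (Σ i : Fin n, Fin (x i))))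
  -- A continuous bijection from a compact space to a Hausdorff space is a homeomorphism.
  Continuous.homeoOfEquivCompactToT2
    (f := Equiv.ofBijective _ ⟨toRayedCircle_injective x hn, toRayedCircle_surjective x hn⟩)
    (continuous_quot_lift _ (continuous_cellPt x))

end sunGraph

theorem theorem1p2 (n : ℕ) (hn : 1 ≤ n) (x : Fin n → ℕ)
    (c : Conf 3 (sunGraph x).Realization) :
    IsFreeGroup (GraphBraidGroup 3 (sunGraph x) c) := by
  have e := sunGraph.homeomorphRayedCircle x hn
  -- Local path connectedness is inherited by the realization from its cells and transported to the
  -- rayed circle.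
  have : LocallyPathConnectedSpace (RayedCircle (sunGraph.rayPos x)) :=
    e.symm.isOpenEmbedding.locallyPathConnectedSpace
  exact (e.confCongr 3).isFreeGroup_fundamentalGroup
    (RayedCircle.isFreeGroup_fundamentalGroup_conf _) c
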